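/- **Setting.** Let $\nu$ be a measure on $\mathbb{R}$, $a>0$, and let $f_t(y)=\exp\{(yt-b(t))/a+c(y,a)\}$, $t\in\mathbb{R}$, be probability densities with respect to $\nu$, with $b$ twice differentiable. For $\theta\in\mathbb{R}^n$ let $P_\theta$ be the law of $Y=(Y_1,\dots,Y_n)$ with independent $Y_i\sim f_{\theta_i}$, let $\mathbb{E}_\theta$ be the expectation under $P_\theta$, and let $KL(\theta,\zeta)$ be the Kullback–Leibler divergence of $P_\theta$ from $P_\zeta$. Assumption (A): $\Theta\subseteq\mathbb{R}$ is a closed (finite or infinite) interval, and $0<\mathcal L\le\mathcal U<\infty$ are such that $b''\le\mathcal U$ on $\mathbb{R}$ and $b''\ge\mathcal L$ on $\Theta$. Let $X\in\mathbb{R}^{n\times p}$ have rank $r$ and let any $r$ of its columns be linearly independent. Let $\mathfrak M$ be a set of subsets $M\subseteq\{1,\dots,p\}$ (admissible models) with $1\le|M|\le r$. For $k<r$ let $m(k)$ be the number of $M\in\mathfrak M$ with $|M|=k$; let $m(r)=1$ if there are $M\in\mathfrak M$ with $|M|=r$, and $m(r)=0$ otherwise (here $\ln 0:=0$). Put $$\mathcal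 B_M=\{\beta\in\mathbb{R}^p:\ \beta_j=0 \text{ iff } j\notin M,\ (X\beta)_i\in\Theta \text{ for all } i\},\qquad \mathcal B(p_0)=\bigcup_{M\in\mathfrak M,\,|M|=p_0}\mathcal B_M .$$ For every $M\in\mathfrak M$ let $\hat\beta_M=\hat\beta_M(Y)$ be an MLE, i.e. a maximizer of $\sum_i\{Y_i(X\beta)_i-b((X\beta)_i)\}$ over $\mathcal B_M$ (as $\mathcal B_M$ need not be closed, a maximizer in its closure is also allowed). For a penalty $Pen$, let $\hat M$ minimize $\frac1a\sum_i\{b((X\hat\beta_M)_i)-Y_i(X\hat\beta_M)_i\}+Pen(|M|)$ over $M\in\mathfrak M$; these properties hold almost surely under each $P_\theta$, $\theta\in\Theta^n$, and $\hat\beta_{\hat M}$ is measurable. **(1) Oracle inequality.** Let Assumption (A) hold and $\theta\in\Theta^n$. Let $L_1,\dots,L_r>0$ and $S\in\mathbb{R}$ satisfy $$\sum_{k=1}^{r-1}m(k)e^{-kL_k}+e^{-rL_r}\le S,$$ and for some $A>1$ let $$Pen(k)\ge 2\frac{\mathcal U}{\mathcal L}k\left(A+2\sqrt{2L_k}+4L_k\right)\quad\text{for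 all }1\le k\le r\text{ with }m(k)\ge1.$$ Then $$\mathbb{E}_\theta KL(\theta,X\hat\beta_{\hat M})\le\frac43\inf_{M\in\mathfrak M}\Big\{\inf_{\beta\in\mathcal B_M}KL(\theta,X\beta)+Pen(|M|)\Big\}+\frac{16}{3}\,\frac{\mathcal U}{\mathcal L}\,\frac{2A-1}{A-1}\,S .$$ **(2) Choice of weights.** For every $c>1$ there is a constant $S$ depending only on $c$ such that $L_k=\frac ck\max(\ln m(k),k)$, $1\le k\le r$, are positive and satisfy the weight condition in (1), for all $n,p,X,\mathfrak M$. Moreover, for every $C>16$ there are $c,A>1$, depending only on $C$, such that with these $L_k$ $$2\frac{\mathcal U}{\mathcal L}k\left(A+2\sqrt{2L_k}+4L_k\right)\le C\,\frac{\mathcal U}{\mathcal L}\max(\ln m(k),k)\quad\text{for all }1\le k\le r\text{ with }m(k)\ge1 .$$ **(3) Risk bounds.** For all $16<C\le C'$ there is a constant $K>0$ depending only on $C,C'$ such that the following holds in every setting as above under Assumption (A). If $$C\,\frac{\mathcal U}{\mathcal L}\max(\ln m(k),k)\le Pen(k)\le C'\,\frac{\mathcal U}{\mathcal L}\max(\ln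 m(k),k)\quad\text{for all }1\le k\le r\text{ with }m(k)\ge1,$$ then for all $1\le p_0\le r$ $$\sup_{\beta\in\mathcal B(p_0)}\mathbb{E}_{X\beta}KL(X\beta,X\hat\beta_{\hat M})\le K\,\frac{\mathcal U}{\mathcal L}\max(\ln m(p_0),p_0),$$ and, if there are admissible models of size $r$, moreover $$\sup_{\beta\in\mathcal B(p_0)}\mathbb{E}_{X\beta}KL(X\beta,X\hat\beta_{\hat M})\le K\,\frac{\mathcal U}{\mathcal L}\min\big(\max(\ln m(p_0),p_0),\,r\big).$$ -/

import Mathlib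

open MeasureTheory Matrix
open scoped ENNReal

/-- A one-parameter natural exponential family with scaling parameter `a`: the densities
`f_t(y) = exp ((y t - b(t)) / a + c(y, a))`, `t ∈ ℝ`, with respect to a dominating measure `ν`
on `ℝ` (Lebesgue measure, counting measure, ...), where `b` is twice differentiable. -/
structure NaturalExpFamily where
  ν : Measure ℝ
  b : ℝ → ℝ
  c : ℝ → ℝ → ℝ
  a : ℝ
  a_pos : 0 < a
  measurable_c : Measurable fun y => c y a
  differentiable_b : Differentiable ℝ b
  differentiable_deriv_b : Differentiable ℝ (deriv b)
  /-- Every `f_t` is a probability density. -/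
  normalized : ∀ t : ℝ, ∫⁻ y, ENNReal.ofReal (Real.exp ((y * t - b t) / a + c y a)) ∂ν = 1

namespace NaturalExpFamily

variable (F : NaturalExpFamily)

/-- The density `f_t`. -/
noncomputable def density (t y : ℝ) : ℝ :=
  Real.exp ((y * t - F.b t) / F.a + F.c y F.a)

/-- The distribution on `ℝ` with density `f_t`. -/
noncomputable def law (t : ℝ) : Measure ℝ :=
  F.ν.withDensity fun y => ENNReal.ofReal (F.density t y)

/-- The joint distribution of independent observations `Y_1, ..., Y_n` with `Y_i ∼ f_{θ_i}`. -/
noncomputable def jointLaw {n : ℕ} (θ : Fin n → ℝ) : Measure (Fin n → ℝ) :=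
  Measure.pi fun i => F.law (θ i)

/-- The Kullback-Leibler divergence `KL(θ, ζ)` between the joint distributions with natural
parameters `θ` and `ζ`. -/
noncomputable def KL {n : ℕ} (θ ζ : Fin n → ℝ) : ℝ≥0∞ :=
  InformationTheory.klDiv (F.jointLaw θ) (F.jointLaw ζ)

/-- The log-likelihood of `β` up to scaling and an additive constant:
`∑ i, (Y_i (Xβ)_i - b((Xβ)_i))`. -/
noncomputable def logLik {n p : ℕ} (X : Matrix (Fin n) (Fin p) ℝ) (y : Fin n → ℝ)
    (β : Fin p → ℝ) : ℝ :=
  ∑ i, (y i * (X *ᵥ β) i - F.b ((X *ᵥ β) i))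

/-- The assumption on the parameter space `Θ` (a closed interval) and on the second derivative
of `b`, with constants `0 < lo ≤ up < ∞`. -/
structure AssumptionA (Θ : Set ℝ) (lo up : ℝ) : Prop where
  isClosed : IsClosed Θ
  ordConnected : Θ.OrdConnected
  lo_pos : 0 < lo
  lo_le_up : lo ≤ up
  le_up : ∀ t : ℝ, deriv (deriv F.b) t ≤ up
  lo_le : ∀ t ∈ Θ, lo ≤ deriv (deriv F.b) t

end NaturalExpFamily

/-- The coefficient set `B_M`: `β_j = 0` iff `j ∉ M`, and `βᵗ x_i ∈ Θ` for all `i`. -/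
def coeffSet {n p : ℕ} (Θ : Set ℝ) (X : Matrix (Fin n) (Fin p) ℝ) (M : Finset (Fin p)) :
    Set (Fin p → ℝ) :=
  {β | (∀ j, β j = 0 ↔ j ∉ M) ∧ ∀ i, (X *ᵥ β) i ∈ Θ}

/-- `B(p₀)`, the union of the `B_M` over the admissible models `M` of size `p₀`. -/
def coeffSetOfSize {n p : ℕ} (Θ : Set ℝ) (X : Matrix (Fin n) (Fin p) ℝ)
    (𝔐 : Finset (Finset (Fin p))) (p₀ : ℕ) : Set (Fin p → ℝ) :=
  ⋃ M ∈ 𝔐, ⋃ _ : M.card = p₀, coeffSet Θ X M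

/-- `m(k)`, the number of admissible models of size `k`, where all admissible models of the
maximal size `r` count as a single one. -/
def modelCount {p : ℕ} (𝔐 : Finset (Finset (Fin p))) (r k : ℕ) : ℕ :=
  if k = r then min 1 (𝔐.filter fun M => M.card = k).card
  else (𝔐.filter fun M => M.card = k).card

/-- `max (ln m(k), k)`. -/
noncomputable def complexity {p : ℕ} (𝔐 : Finset (Finset (Fin p))) (r k : ℕ) : ℝ :=
  max (Real.log (modelCount 𝔐 r k)) k

/-- Standing assumptions on the design and the admissible models, with `r = rank X`: any `r`
columns of `X` are linearly independent, and admissible models have sizes between `1` and `r`. -/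
structure AdmissibleModels {n p : ℕ} (X : Matrix (Fin n) (Fin p) ℝ)
    (𝔐 : Finset (Finset (Fin p))) : Prop where
  linearIndependent : ∀ s : Finset (Fin p), s.card = X.rank →
    LinearIndependent ℝ fun j : s => X.col j
  one_le_card : ∀ M ∈ 𝔐, 1 ≤ M.card
  card_le_rank : ∀ M ∈ 𝔐, M.card ≤ X.rank

/-- `β` is a maximum likelihood estimate for the model `M` given the data `y`. As `B_M` need not
be closed, a maximizer is also allowed to lie in the closure of `B_M`; a maximizer inside `B_M`
is a special case. -/
def IsMLE {n p : ℕ} (F : NaturalExpFamily) (Θ : Set ℝ) (X : Matrix (Fin n) (Fin p) ℝ)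
    (M : Finset (Fin p)) (y : Fin n → ℝ) (β : Fin p → ℝ) : Prop :=
  β ∈ closure (coeffSet Θ X M) ∧ ∀ β' ∈ coeffSet Θ X M, F.logLik X y β' ≤ F.logLik X y β

/-- For almost all data `y`, `βhat M y` is the MLE for every admissible model `M`, and
`Mhat y` minimizes `(1/a) (b(X βhat_M)ᵗ 1 - Yᵗ X βhat_M) + Pen(|M|)` over the admissible models;
the resulting estimator is measurable. -/
def IsPenalizedMLE {n p : ℕ} (F : NaturalExpFamily) (Θ : Set ℝ) (X : Matrix (Fin n) (Fin p) ℝ)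
    (𝔐 : Finset (Finset (Fin p))) (Pen : ℕ → ℝ)
    (βhat : Finset (Fin p) → (Fin n → ℝ) → (Fin p → ℝ))
    (Mhat : (Fin n → ℝ) → Finset (Fin p)) : Prop :=
  ∀ θ : Fin n → ℝ, (∀ i, θ i ∈ Θ) →
    AEMeasurable (fun y => βhat (Mhat y) y) (F.jointLaw θ) ∧
    ∀ᵐ y ∂F.jointLaw θ,
      (∀ M ∈ 𝔐, IsMLE F Θ X M y (βhat M y)) ∧
      Mhat y ∈ 𝔐 ∧
      ∀ M ∈ 𝔐,
        -(1 / F.a) * F.logLik X y (βhat (Mhat y) y) + Pen (Mhat y).card ≤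
          -(1 / F.a) * F.logLik X y (βhat M y) + Pen M.card

/-- The Kullback-Leibler risk `E KL(θ, X βhat_{Mhat})`, the expectation being taken with respect
to the distribution of the data with natural parameters `θ`. -/
noncomputable def klRisk {n p : ℕ} (F : NaturalExpFamily) (X : Matrix (Fin n) (Fin p) ℝ)
    (βhat : Finset (Fin p) → (Fin n → ℝ) → (Fin p → ℝ))
    (Mhat : (Fin n → ℝ) → Finset (Fin p)) (θ : Fin n → ℝ) : ℝ≥0∞ :=
  ∫⁻ y, F.KL θ (X *ᵥ βhat (Mhat y) y) ∂F.jointLaw θ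

/-- The condition `∑_{k<r} m(k) e^{-k w_k} + e^{-r w_r} ≤ S` on positive weights `w_1, ..., w_r`. -/
def WeightCondition {p : ℕ} (𝔐 : Finset (Finset (Fin p))) (r : ℕ) (w : ℕ → ℝ) (S : ℝ) : Prop :=
  (∀ k, 1 ≤ k → k ≤ r → 0 < w k) ∧
    ∑ k ∈ Finset.Ico 1 r, (modelCount 𝔐 r k : ℝ) * Real.exp (-(k * w k))
      + Real.exp (-(r * w r)) ≤ S

/-- The lower bound for the penalty, `2 (up/lo) k (A + 2 √(2 w_k) + 4 w_k)`. -/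
noncomputable def penaltyBound (lo up A : ℝ) (w : ℕ → ℝ) (k : ℕ) : ℝ :=
  2 * (up / lo) * k * (A + 2 * √(2 * w k) + 4 * w k)

/-- The weights `w_k = (c / k) max (ln m(k), k)`. -/
noncomputable def complexityWeight {p : ℕ} (𝔐 : Finset (Finset (Fin p))) (r : ℕ) (c : ℝ)
    (k : ℕ) : ℝ :=
  c * (1 / k) * complexity 𝔐 r k

/-!
Write `ε = Y - b'(θ)` for the noise, `L = lo` and `U = up`. The divergence `KL(θ, ζ)` is `1 / a`
times a sum of Bregman divergences of `b` (`NaturalExpFamily.KL_eq_ofReal`), hence at least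
`L / (2 a) * ‖ζ - θ‖²` if the parameters lie in `Θ`. Up to a constant, the penalized likelihood
criterion is `KL(θ, X β) - ⟨ε, X β⟩ / a + Pen`. Comparing the selected estimator `ζ'` with a
fixed `ζ = X β` gives

`KL(θ, ζ') + Pen(M') ≤ KL(θ, ζ) + Pen(M) + ⟨ε, θ - ζ⟩ / a + ⟨ε, ζ' - θ⟩ / a`,

where `⟨ε, θ - ζ⟩` has mean zero. It remains to bound `⟨ε, ζ' - θ⟩ / a` by a quarter of
`KL(θ, ζ')`, the penalty of `M'`, and a remainder of mean of order `(U / L) S`.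

Let `V` be the span of the columns in `M'` and `u = θ - P_V θ`. Since `ζ' ∈ V`, the vector `ζ' - θ`
is the orthogonal sum of `ζ' - P_V θ ∈ V` and `-u`. The Cauchy-Schwarz inequality for the first part,
and no estimate at all for the second, lead to the `excess` of `V`: a squared norm
`‖P_V ε‖² / (a U)`, plus a multiple of `⟨ε, u⟩`, minus a multiple of `‖u‖²`
(`NaturalExpFamily.noise_le_excess`). As `b'' ≤ U`, the noise is sub-Gaussian with variance proxy
`a U`; as `u` is orthogonal to `V`, the excess has the exponential moments of a chi-square variable
with `dim V` degrees of freedom (`NaturalExpFamily.lintegral_exp_excess_le`). This is shown by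
writing each `exp (z² / 2)` as a Gaussian average of `exp (z g)`. An exponential Markov inequality
with a suitable exponent (`exists_chernoff_exponent`) and a union bound over the admissible models,
in which all models of size `r = rank X` share one subspace, control the deviations of all excesses
beyond the penalties at once (`NaturalExpFamily.exists_integrable_forall_excess_le`).

For the complexity weights the sum in the weight condition is dominated by a geometric series. The
risk bounds follow by applying the oracle inequality to the true model, which has no approximation
error, and to a model of size `r`: by the rank condition it represents every `X β`, with
coefficients in the closure of its coefficient set, and the oracle inequality extends to that closure
(`klRisk_le_of_mem_closure`).
-/

/-! ### Product measures -/

theorem lintegral_pi_prod_eq_prod {ι : Type*} [Fintype ι] {α : ι → Type*}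
    [∀ i, MeasurableSpace (α i)] (μ : ∀ i, Measure (α i)) [∀ i, IsProbabilityMeasure (μ i)]
    {f : ∀ i, α i → ℝ≥0∞} (hf : ∀ i, Measurable (f i)) :
    ∫⁻ x, ∏ i, f i (x i) ∂Measure.pi μ = ∏ i, ∫⁻ x, f i x ∂μ i := by
  have h := ProbabilityTheory.lintegral_prod_eq_prod_lintegral_of_indepFun (μ := Measure.pi μ)
    Finset.univ (fun i (x : ∀ i, α i) => f i (x i))
    (ProbabilityTheory.iIndepFun_pi (X := f) fun i => (hf i).aemeasurable)
    (fun i => (hf i).comp (measurable_pi_apply i))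
  rw [h]
  refine Finset.prod_congr rfl fun i _ => ?_
  exact (measurePreserving_eval μ i).lintegral_comp (hf i)

theorem pi_withDensity_eq {ι : Type*} [Fintype ι] {α : ι → Type*}
    [∀ i, MeasurableSpace (α i)] (μ : ∀ i, Measure (α i)) [∀ i, IsProbabilityMeasure (μ i)]
    {f : ∀ i, α i → ℝ≥0∞} (hf : ∀ i, Measurable (f i))
    [∀ i, SigmaFinite ((μ i).withDensity (f i))] :
    Measure.pi (fun i => (μ i).withDensity (f i)) =
      (Measure.pi μ).withDensity fun x => ∏ i, f i (x i) := by
  classical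
  refine (Measure.pi_eq fun s hs => ?_)
  rw [withDensity_apply _ (MeasurableSet.univ_pi hs),
    ← lintegral_indicator (MeasurableSet.univ_pi hs)]
  have h : ∀ x : ∀ i, α i, (Set.univ.pi s).indicator (fun x => ∏ i, f i (x i)) x =
      ∏ i, (s i).indicator (f i) (x i) := by
    intro x
    by_cases hx : x ∈ Set.univ.pi s
    · rw [Set.indicator_of_mem hx]
      exact Finset.prod_congr rfl fun i _ => by
        rw [Set.indicator_of_mem (hx i (Set.mem_univ i))]
    · rw [Set.indicator_of_notMem hx]
      simp only [Set.mem_pi, Set.mem_univ, true_implies, not_forall] at hx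
      obtain ⟨i, hi⟩ := hx
      exact (Finset.prod_eq_zero (Finset.mem_univ i) (Set.indicator_of_notMem hi _)).symm
  simp_rw [h]
  rw [lintegral_pi_prod_eq_prod μ fun i => (hf i).indicator (hs i)]
  refine Finset.prod_congr rfl fun i _ => ?_
  rw [lintegral_indicator (hs i), withDensity_apply _ (hs i)]

/-! ### The exponential family -/

/-! ### Convexity -/

/-- A twice differentiable function with nonnegative second derivative on an interval lies above
its tangents there. -/
theorem tangent_le_of_deriv2_nonneg {f : ℝ → ℝ} {D : Set ℝ} (hD : D.OrdConnected)
    (hf : Differentiable ℝ f) (hf' : Differentiable ℝ (deriv f))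
    (h : ∀ x ∈ D, 0 ≤ deriv (deriv f) x) {t s : ℝ} (ht : t ∈ D) (hs : s ∈ D) :
    0 ≤ f s - f t - deriv f t * (s - t) := by
  have hmono : MonotoneOn (deriv f) D :=
    monotoneOn_of_deriv_nonneg hD.convex hf'.continuous.continuousOn
      hf'.differentiableOn fun x hx => h x (interior_subset hx)
  rcases lt_trichotomy t s with hts | rfl | hts
  · obtain ⟨x, hx, hxs⟩ := exists_deriv_eq_slope f hts hf.continuous.continuousOn
      hf.differentiableOn
    have := hmono ht (hD.out ht hs ⟨hx.1.le, hx.2.le⟩) hx.1.le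
    rw [hxs, le_div_iff₀ (sub_pos.2 hts)] at this
    linarith
  · simp
  · obtain ⟨x, hx, hxs⟩ := exists_deriv_eq_slope f hts hf.continuous.continuousOn
      hf.differentiableOn
    have := hmono (hD.out hs ht ⟨hx.1.le, hx.2.le⟩) ht hx.2.le
    rw [hxs, div_le_iff₀ (sub_pos.2 hts)] at this
    linarith

namespace NaturalExpFamily

variable (F : NaturalExpFamily)

theorem measurable_density (t : ℝ) : Measurable (F.density t) := by
  have := F.measurable_c
  unfold density
  fun_prop

instance isProbabilityMeasure_law (t : ℝ) : IsProbabilityMeasure (F.law t) := by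
  constructor
  rw [law, withDensity_apply _ MeasurableSet.univ, setLIntegral_univ]
  exact F.normalized t

instance isProbabilityMeasure_jointLaw {n : ℕ} (θ : Fin n → ℝ) :
    IsProbabilityMeasure (F.jointLaw θ) := by
  unfold jointLaw
  infer_instance

/-- Two members of the family differ by an exponential tilt. -/
theorem law_eq_withDensity (s t : ℝ) :
    F.law t = (F.law s).withDensity
      fun y => ENNReal.ofReal (Real.exp ((y * (t - s) - (F.b t - F.b s)) / F.a)) := by
  have h1 : Measurable fun y => ENNReal.ofReal (F.density s y) :=
    (F.measurable_density s).ennreal_ofReal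
  rw [law, law, ← withDensity_mul _ h1 (by fun_prop)]
  congr 1
  ext y
  rw [Pi.mul_apply, ← ENNReal.ofReal_mul (by unfold density; positivity), density, density,
    ← Real.exp_add]
  congr 2
  ring

theorem jointLaw_eq_withDensity {n : ℕ} (θ ζ : Fin n → ℝ) :
    F.jointLaw θ = (F.jointLaw ζ).withDensity fun y => ENNReal.ofReal
      (Real.exp (∑ i, (y i * (θ i - ζ i) - (F.b (θ i) - F.b (ζ i))) / F.a)) := by
  have h : ∀ i, F.law (θ i) = (F.law (ζ i)).withDensity
      fun y => ENNReal.ofReal (Real.exp ((y * (θ i - ζ i) - (F.b (θ i) - F.b (ζ i))) / F.a)) :=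
    fun i => F.law_eq_withDensity _ _
  have : ∀ i, SigmaFinite ((F.law (ζ i)).withDensity fun y =>
      ENNReal.ofReal (Real.exp ((y * (θ i - ζ i) - (F.b (θ i) - F.b (ζ i))) / F.a))) := by
    intro i
    rw [← h i]
    infer_instance
  unfold jointLaw
  simp_rw [h]
  rw [pi_withDensity_eq _ fun i => by fun_prop]
  congr 1
  ext y
  rw [Real.exp_sum, ENNReal.ofReal_prod_of_nonneg fun i _ => (Real.exp_pos _).le]

/-- The Laplace transform of an observation. -/
theorem lintegral_exp_mul_law (t s : ℝ) :
    ∫⁻ y, ENNReal.ofReal (Real.exp (s * y)) ∂F.law t =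
      ENNReal.ofReal (Real.exp ((F.b (t + F.a * s) - F.b t) / F.a)) := by
  have ha := F.a_pos.ne'
  have h := measure_univ (μ := F.law (t + F.a * s))
  rw [F.law_eq_withDensity t, withDensity_apply _ MeasurableSet.univ, setLIntegral_univ] at h
  have h2 : ∀ y, ENNReal.ofReal (Real.exp (s * y)) =
      ENNReal.ofReal (Real.exp ((F.b (t + F.a * s) - F.b t) / F.a)) * ENNReal.ofReal
        (Real.exp ((y * (t + F.a * s - t) - (F.b (t + F.a * s) - F.b t)) / F.a)) := by
    intro y
    rw [← ENNReal.ofReal_mul (Real.exp_pos _).le, ← Real.exp_add]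
    congr 2
    field_simp
    ring
  simp_rw [h2]
  rw [lintegral_const_mul _ (by fun_prop), h, mul_one]

theorem integrable_exp_mul_law (t s : ℝ) :
    Integrable (fun y => Real.exp (s * y)) (F.law t) := by
  refine (lintegral_ofReal_ne_top_iff_integrable (by fun_prop)
    (ae_of_all _ fun y => (Real.exp_pos _).le)).1 ?_
  rw [lintegral_exp_mul_law]
  exact ENNReal.ofReal_ne_top

theorem mgf_law (t s : ℝ) :
    ProbabilityTheory.mgf id (F.law t) s = Real.exp ((F.b (t + F.a * s) - F.b t) / F.a) := by
  rw [ProbabilityTheory.mgf, integral_eq_lintegral_of_nonneg_ae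
    (ae_of_all _ fun y => (Real.exp_pos _).le) (by fun_prop)]
  simp only [id]
  rw [lintegral_exp_mul_law, ENNReal.toReal_ofReal (Real.exp_pos _).le]

theorem integrableExpSet_law (t : ℝ) :
    ProbabilityTheory.integrableExpSet id (F.law t) = Set.univ :=
  Set.eq_univ_of_forall fun s => F.integrable_exp_mul_law t s

theorem integrable_id_law (t : ℝ) : Integrable id (F.law t) :=
  ProbabilityTheory.integrable_of_mem_interior_integrableExpSet
    (by simp [integrableExpSet_law])

theorem integral_id_law (t : ℝ) : ∫ y, y ∂F.law t = deriv F.b t := by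
  have ha := F.a_pos.ne'
  have h := ProbabilityTheory.deriv_mgf_zero (X := id) (μ := F.law t)
    (by simp [integrableExpSet_law])
  simp only [id] at h
  rw [← h, funext (F.mgf_law t)]
  have hb : HasDerivAt F.b (deriv F.b t) (t + F.a * 0) := by
    simpa using (F.differentiable_b t).hasDerivAt
  have h1 : HasDerivAt (fun s => t + F.a * s) F.a 0 := by
    simpa using ((hasDerivAt_id (0 : ℝ)).const_mul F.a).const_add t
  have h2 := (((hb.comp 0 h1).sub_const (F.b t)).div_const F.a).exp
  refine h2.deriv.trans ?_
  simp [ha]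

/-! ### The noise -/

/-- The noise `⟨Y - b'(θ), v⟩` in the direction `v`. -/
noncomputable def noise {n : ℕ} (θ y v : Fin n → ℝ) : ℝ :=
  ∑ i, (y i - deriv F.b (θ i)) * v i

@[fun_prop]
theorem measurable_noise {n : ℕ} (θ v : Fin n → ℝ) : Measurable fun y => F.noise θ y v := by
  unfold noise
  fun_prop

theorem noise_sub {n : ℕ} (θ y v w : Fin n → ℝ) :
    F.noise θ y (v - w) = F.noise θ y v - F.noise θ y w := by
  simp [noise, mul_sub]

theorem integrable_eval_jointLaw {n : ℕ} (θ : Fin n → ℝ) (i : Fin n) :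
    Integrable (fun y => y i) (F.jointLaw θ) :=
  integrable_eval (F.integrable_id_law (θ i))

theorem integral_eval_jointLaw {n : ℕ} (θ : Fin n → ℝ) (i : Fin n) :
    ∫ y, y i ∂F.jointLaw θ = deriv F.b (θ i) := by
  rw [← integral_id_law]
  exact integral_comp_eval (μ := fun i => F.law (θ i)) (f := fun x => x)
    (by fun_prop)

theorem integrable_noise {n : ℕ} (θ v : Fin n → ℝ) :
    Integrable (fun y => F.noise θ y v) (F.jointLaw θ) :=
  integrable_finsetSum _ fun i _ =>
    ((F.integrable_eval_jointLaw θ i).sub (integrable_const _)).mul_const _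

theorem integral_noise {n : ℕ} (θ v : Fin n → ℝ) :
    ∫ y, F.noise θ y v ∂F.jointLaw θ = 0 := by
  unfold noise
  have hi : ∀ i ∈ Finset.univ, Integrable (fun y : Fin n → ℝ =>
      (y i - deriv F.b (θ i)) * v i) (F.jointLaw θ) := fun i _ =>
    ((F.integrable_eval_jointLaw θ i).sub (integrable_const _)).mul_const _
  rw [integral_finsetSum _ hi]
  refine Finset.sum_eq_zero fun i _ => ?_
  rw [integral_mul_const, integral_sub (F.integrable_eval_jointLaw θ i) (integrable_const _),
    integral_eval_jointLaw]
  simp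

/-! ### The Kullback-Leibler divergence -/

/-- The value of the Kullback-Leibler divergence `KL(θ, ζ)`: the sum of the Bregman divergences
of `b`, divided by `a`. -/
noncomputable def klReal {n : ℕ} (θ ζ : Fin n → ℝ) : ℝ :=
  (1 / F.a) * ∑ i, (F.b (ζ i) - F.b (θ i) - deriv F.b (θ i) * (ζ i - θ i))

theorem klReal_self {n : ℕ} (θ : Fin n → ℝ) : F.klReal θ θ = 0 := by
  simp [klReal]

/-- The log-likelihood ratio is affine in the observations, so its mean only involves the means
`b'(θ_i)`. -/
theorem KL_eq_ofReal {n : ℕ} (θ ζ : Fin n → ℝ) :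
    F.KL θ ζ = ENNReal.ofReal (F.klReal θ ζ) := by
  set g : (Fin n → ℝ) → ℝ :=
    fun y => ∑ i, (y i * (θ i - ζ i) - (F.b (θ i) - F.b (ζ i))) / F.a with hg
  have hgm : Measurable g := by fun_prop
  have hd : F.jointLaw θ = (F.jointLaw ζ).withDensity fun y => ENNReal.ofReal (Real.exp (g y)) :=
    F.jointLaw_eq_withDensity θ ζ
  have hac : F.jointLaw θ ≪ F.jointLaw ζ := by
    rw [hd]
    exact withDensity_absolutelyContinuous _ _
  have hr : (F.jointLaw θ).rnDeriv (F.jointLaw ζ) =ᵐ[F.jointLaw ζ]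
      fun y => ENNReal.ofReal (Real.exp (g y)) := by
    conv_lhs => rw [hd]
    exact Measure.rnDeriv_withDensity _ (by fun_prop)
  have hllr : llr (F.jointLaw θ) (F.jointLaw ζ) =ᵐ[F.jointLaw θ] g := by
    filter_upwards [hac.ae_le hr] with y hy
    rw [llr, hy, ENNReal.toReal_ofReal (Real.exp_pos _).le, Real.log_exp]
  have hi : ∀ i, Integrable (fun y : Fin n → ℝ =>
      (y i * (θ i - ζ i) - (F.b (θ i) - F.b (ζ i))) / F.a) (F.jointLaw θ) := fun i =>
    (((F.integrable_eval_jointLaw θ i).mul_const _).sub (integrable_const _)).div_const _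
  have hint : Integrable g (F.jointLaw θ) := integrable_finsetSum _ fun i _ => hi i
  rw [KL, InformationTheory.klDiv_of_ac_of_integrable hac ((integrable_congr hllr).2 hint),
    integral_congr_ae hllr, hg, integral_finsetSum _ fun i _ => hi i]
  simp only [probReal_univ, add_sub_cancel_right]
  rw [klReal, Finset.mul_sum]
  congr 1
  refine Finset.sum_congr rfl fun i _ => ?_
  rw [integral_div, integral_sub ((F.integrable_eval_jointLaw θ i).mul_const _)
    (integrable_const _), integral_mul_const, integral_eval_jointLaw]
  simp
  ring

/-- Up to a term that does not depend on `β`, the normalized negative log-likelihood is the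
divergence from the true parameters minus the noise in the direction `X β`. -/
theorem neg_logLik_eq {n p : ℕ} (X : Matrix (Fin n) (Fin p) ℝ) (θ y : Fin n → ℝ)
    (β : Fin p → ℝ) :
    -(1 / F.a) * F.logLik X y β = F.klReal θ (X *ᵥ β) - (1 / F.a) * F.noise θ y (X *ᵥ β)
      + (1 / F.a) * ∑ i, (F.b (θ i) - deriv F.b (θ i) * θ i) := by
  rw [logLik, klReal, noise, ← mul_sub, ← mul_add, ← Finset.sum_sub_distrib,
    ← Finset.sum_add_distrib, neg_mul, ← mul_neg, ← Finset.sum_neg_distrib]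
  congr 1
  refine Finset.sum_congr rfl fun i _ => ?_
  ring

/-! ### Curvature bounds -/

theorem bregman_le {up : ℝ} (h : ∀ t, deriv (deriv F.b) t ≤ up) (t s : ℝ) :
    F.b s - F.b t - deriv F.b t * (s - t) ≤ up / 2 * (s - t) ^ 2 := by
  have hb := F.differentiable_b
  have hb' := F.differentiable_deriv_b
  have hd : deriv (fun x => up / 2 * x ^ 2 - F.b x) = fun x => up * x - deriv F.b x := by
    ext x
    refine ((((hasDerivAt_pow 2 x).const_mul (up / 2)).sub (hb x).hasDerivAt).congr_deriv ?_).deriv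
    simp
    ring
  have hd2 : ∀ x, deriv (fun x => up * x - deriv F.b x) x = up - deriv (deriv F.b) x := by
    intro x
    exact ((((hasDerivAt_id x).const_mul up).sub (hb' x).hasDerivAt).congr_deriv (by simp)).deriv
  have := tangent_le_of_deriv2_nonneg (f := fun x => up / 2 * x ^ 2 - F.b x)
    Set.ordConnected_univ (by fun_prop) (by rw [hd]; fun_prop)
    (fun x _ => by rw [hd, hd2]; linarith [h x]) (Set.mem_univ t) (Set.mem_univ s)
  rw [hd] at this
  simp only at this
  nlinarith

theorem le_bregman {Θ : Set ℝ} {lo : ℝ} (hΘ : Θ.OrdConnected)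
    (h : ∀ t ∈ Θ, lo ≤ deriv (deriv F.b) t) {t s : ℝ} (ht : t ∈ Θ) (hs : s ∈ Θ) :
    lo / 2 * (s - t) ^ 2 ≤ F.b s - F.b t - deriv F.b t * (s - t) := by
  have hb := F.differentiable_b
  have hb' := F.differentiable_deriv_b
  have hd : deriv (fun x => F.b x - lo / 2 * x ^ 2) = fun x => deriv F.b x - lo * x := by
    ext x
    refine (((hb x).hasDerivAt.sub ((hasDerivAt_pow 2 x).const_mul (lo / 2))).congr_deriv ?_).deriv
    simp
    ring
  have hd2 : ∀ x, deriv (fun x => deriv F.b x - lo * x) x = deriv (deriv F.b) x - lo := by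
    intro x
    exact (((hb' x).hasDerivAt.sub ((hasDerivAt_id x).const_mul lo)).congr_deriv (by simp)).deriv
  have := tangent_le_of_deriv2_nonneg (f := fun x => F.b x - lo / 2 * x ^ 2)
    hΘ (by fun_prop) (by rw [hd]; fun_prop)
    (fun x hx => by rw [hd, hd2]; linarith [h x hx]) ht hs
  rw [hd] at this
  simp only at this
  nlinarith

theorem klReal_nonneg {n : ℕ} {Θ : Set ℝ} {lo up : ℝ} (hA : F.AssumptionA Θ lo up)
    {θ ζ : Fin n → ℝ} (hθ : ∀ i, θ i ∈ Θ) (hζ : ∀ i, ζ i ∈ Θ) : 0 ≤ F.klReal θ ζ := by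
  have ha := F.a_pos
  have hlo := hA.lo_pos
  refine mul_nonneg (by positivity) (Finset.sum_nonneg fun i _ => ?_)
  exact le_trans (by positivity) (F.le_bregman hA.ordConnected hA.lo_le (hθ i) (hζ i))

theorem le_klReal {n : ℕ} {Θ : Set ℝ} {lo up : ℝ} (hA : F.AssumptionA Θ lo up)
    {θ ζ : Fin n → ℝ} (hθ : ∀ i, θ i ∈ Θ) (hζ : ∀ i, ζ i ∈ Θ) :
    lo / (2 * F.a) * ∑ i, (ζ i - θ i) ^ 2 ≤ F.klReal θ ζ := by
  have ha := F.a_pos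
  have : lo / (2 * F.a) * ∑ i, (ζ i - θ i) ^ 2 =
      (1 / F.a) * ∑ i, lo / 2 * (ζ i - θ i) ^ 2 := by
    rw [← Finset.mul_sum]
    ring
  rw [this]
  exact mul_le_mul_of_nonneg_left (Finset.sum_le_sum fun i _ =>
    F.le_bregman hA.ordConnected hA.lo_le (hθ i) (hζ i)) (by positivity)

end NaturalExpFamily

/-! ### Gaussian integrals -/

theorem lintegral_exp_mul_gaussianReal (z : ℝ) :
    ∫⁻ g, ENNReal.ofReal (Real.exp (z * g)) ∂ProbabilityTheory.gaussianReal 0 1 =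
      ENNReal.ofReal (Real.exp (z ^ 2 / 2)) := by
  have h := congrFun (ProbabilityTheory.mgf_fun_id_gaussianReal (μ := 0) (v := 1)) z
  rw [ProbabilityTheory.mgf] at h
  rw [← ofReal_integral_eq_lintegral_ofReal
    (ProbabilityTheory.integrable_exp_mul_gaussianReal z)
    (ae_of_all _ fun g => (Real.exp_pos _).le), h]
  simp

theorem lintegral_exp_sq_gaussianReal {c : ℝ} (hc : c < 1) :
    ∫⁻ g, ENNReal.ofReal (Real.exp (c * g ^ 2 / 2)) ∂ProbabilityTheory.gaussianReal 0 1 =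
      ENNReal.ofReal (√(1 - c))⁻¹ := by
  have hc' : 0 < (1 - c) / 2 := by linarith
  rw [ProbabilityTheory.gaussianReal_of_var_ne_zero _ one_ne_zero,
    lintegral_withDensity_eq_lintegral_mul _ (ProbabilityTheory.measurable_gaussianPDF 0 1)
      (by fun_prop)]
  have h : ∀ g, (ProbabilityTheory.gaussianPDF 0 1 *
      fun g => ENNReal.ofReal (Real.exp (c * g ^ 2 / 2))) g =
      ENNReal.ofReal ((√(2 * Real.pi))⁻¹ * Real.exp (-((1 - c) / 2) * g ^ 2)) := by
    intro g
    rw [Pi.mul_apply, ProbabilityTheory.gaussianPDF,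
      ← ENNReal.ofReal_mul (ProbabilityTheory.gaussianPDFReal_nonneg _ _ _),
      ProbabilityTheory.gaussianPDFReal, mul_assoc, ← Real.exp_add]
    congr 3
    · simp
    · simp
      ring
  simp_rw [h]
  rw [← ofReal_integral_eq_lintegral_ofReal
    ((integrable_exp_neg_mul_sq hc').const_mul _) (ae_of_all _ fun g => by positivity),
    integral_const_mul, integral_gaussian]
  congr 1
  rw [← Real.sqrt_inv, ← Real.sqrt_inv, ← Real.sqrt_mul (by positivity)]
  congr 1
  have : 1 - c ≠ 0 := by linarith
  field_simp

/-! ### Exponential moments of quadratic functionals of the noise -/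

namespace NaturalExpFamily

variable (F : NaturalExpFamily)

/-- The vector `Y - b'(θ)` as an element of Euclidean space. -/
noncomputable def residual {n : ℕ} (θ y : Fin n → ℝ) : EuclideanSpace ℝ (Fin n) :=
  WithLp.toLp 2 fun i => y i - deriv F.b (θ i)

@[fun_prop]
theorem measurable_residual {n : ℕ} (θ : Fin n → ℝ) : Measurable (F.residual θ) := by
  unfold residual
  fun_prop

theorem inner_residual {n : ℕ} (θ y : Fin n → ℝ) (v : EuclideanSpace ℝ (Fin n)) :
    inner ℝ (F.residual θ y) v = F.noise θ y v.ofLp := by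
  simp [residual, noise, PiLp.inner_apply, mul_comm]

/-- The noise is sub-Gaussian with variance proxy `a * up`. -/
theorem lintegral_exp_noise_le {up : ℝ} (h : ∀ t, deriv (deriv F.b) t ≤ up) {n : ℕ}
    (θ v : Fin n → ℝ) :
    ∫⁻ y, ENNReal.ofReal (Real.exp (F.noise θ y v)) ∂F.jointLaw θ ≤
      ENNReal.ofReal (Real.exp (F.a * up * (∑ i, v i ^ 2) / 2)) := by
  have ha := F.a_pos
  have h1 : ∀ y, ENNReal.ofReal (Real.exp (F.noise θ y v)) =
      ∏ i, ENNReal.ofReal (Real.exp (-(deriv F.b (θ i) * v i))) *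
        ENNReal.ofReal (Real.exp (v i * y i)) := by
    intro y
    rw [noise, Real.exp_sum, ENNReal.ofReal_prod_of_nonneg fun i _ => (Real.exp_pos _).le]
    refine Finset.prod_congr rfl fun i _ => ?_
    rw [← ENNReal.ofReal_mul (Real.exp_pos _).le, ← Real.exp_add]
    congr 2
    ring
  simp_rw [h1]
  rw [jointLaw, lintegral_pi_prod_eq_prod (fun i => F.law (θ i))
    (f := fun i t => ENNReal.ofReal (Real.exp (-(deriv F.b (θ i) * v i))) *
        ENNReal.ofReal (Real.exp (v i * t))) fun i => by fun_prop]
  have h2 : F.a * up * (∑ i, v i ^ 2) / 2 = ∑ i, F.a * up * v i ^ 2 / 2 := by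
    rw [Finset.mul_sum, Finset.sum_div]
  rw [h2, Real.exp_sum, ENNReal.ofReal_prod_of_nonneg fun i _ => (Real.exp_pos _).le]
  refine Finset.prod_le_prod' fun i _ => ?_
  rw [lintegral_const_mul _ (by fun_prop), lintegral_exp_mul_law,
    ← ENNReal.ofReal_mul (Real.exp_pos _).le, ← Real.exp_add]
  refine ENNReal.ofReal_le_ofReal (Real.exp_le_exp.2 ?_)
  have h3 := F.bregman_le h (θ i) (θ i + F.a * v i)
  rw [neg_add_le_iff_le_add, div_le_iff₀ ha]
  nlinarith

theorem lintegral_exp_inner_residual_le {up : ℝ} (h : ∀ t, deriv (deriv F.b) t ≤ up) {n : ℕ}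
    (θ : Fin n → ℝ) (v : EuclideanSpace ℝ (Fin n)) :
    ∫⁻ y, ENNReal.ofReal (Real.exp (inner ℝ (F.residual θ y) v)) ∂F.jointLaw θ ≤
      ENNReal.ofReal (Real.exp (F.a * up * ‖v‖ ^ 2 / 2)) := by
  simp_rw [inner_residual]
  rw [EuclideanSpace.real_norm_sq_eq]
  exact F.lintegral_exp_noise_le h θ v.ofLp

/-- Exponential moments of a chi-square type functional of the noise plus an orthogonal linear one.
Each square is linearized by an auxiliary standard Gaussian variable `g`, through
`exp (z² / 2) = E exp (z g)`, and the sub-Gaussian bound is applied for fixed `g`. -/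
theorem lintegral_exp_sum_sq_residual_le {up : ℝ} (h : ∀ t, deriv (deriv F.b) t ≤ up) {n : ℕ}
    (θ : Fin n → ℝ) {ι : Type*} {e : ι → EuclideanSpace ℝ (Fin n)} (he : Orthonormal ℝ e)
    {l : ℝ} (hl : 0 ≤ l) (hl' : F.a * up * l < 1) (s : Finset ι) :
    ∀ v : EuclideanSpace ℝ (Fin n), (∀ j ∈ s, inner ℝ v (e j) = 0) →
    ∫⁻ y, ENNReal.ofReal (Real.exp (l / 2 * ∑ j ∈ s, inner ℝ (F.residual θ y) (e j) ^ 2 +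
        inner ℝ (F.residual θ y) v)) ∂F.jointLaw θ ≤
      ENNReal.ofReal ((√(1 - F.a * up * l))⁻¹ ^ s.card *
        Real.exp (F.a * up * ‖v‖ ^ 2 / 2)) := by
  classical
  induction s using Finset.induction_on with
  | empty => simpa using F.lintegral_exp_inner_residual_le h θ
  | insert j₀ s hj₀ ih =>
    intro v hv
    have hint : ∀ y, ENNReal.ofReal (Real.exp (l / 2 * ∑ j ∈ insert j₀ s,
          inner ℝ (F.residual θ y) (e j) ^ 2 + inner ℝ (F.residual θ y) v)) =
        ∫⁻ g, ENNReal.ofReal (Real.exp (l / 2 * ∑ j ∈ s, inner ℝ (F.residual θ y) (e j) ^ 2 +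
          inner ℝ (F.residual θ y) (v + (√l * g) • e j₀)))
          ∂ProbabilityTheory.gaussianReal 0 1 := by
      intro y
      have h1 : ∀ g : ℝ, ENNReal.ofReal (Real.exp (l / 2 * ∑ j ∈ s,
            inner ℝ (F.residual θ y) (e j) ^ 2 +
            inner ℝ (F.residual θ y) (v + (√l * g) • e j₀))) =
          ENNReal.ofReal (Real.exp (l / 2 * ∑ j ∈ s, inner ℝ (F.residual θ y) (e j) ^ 2 +
            inner ℝ (F.residual θ y) v)) *
          ENNReal.ofReal (Real.exp ((√l * inner ℝ (F.residual θ y) (e j₀)) * g)) := by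
        intro g
        rw [← ENNReal.ofReal_mul (Real.exp_pos _).le, ← Real.exp_add, inner_add_right,
          inner_smul_right]
        congr 2
        ring
      simp_rw [h1]
      rw [lintegral_const_mul _ (by fun_prop), lintegral_exp_mul_gaussianReal,
        ← ENNReal.ofReal_mul (Real.exp_pos _).le, ← Real.exp_add, Finset.sum_insert hj₀,
        mul_pow, Real.sq_sqrt hl]
      congr 2
      ring
    simp_rw [hint]
    rw [lintegral_lintegral_swap (by fun_prop)]
    have hnorm : ∀ g : ℝ, ‖v + (√l * g) • e j₀‖ ^ 2 = ‖v‖ ^ 2 + l * g ^ 2 := by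
      intro g
      rw [@norm_add_sq_real, inner_smul_right, hv j₀ (Finset.mem_insert_self _ _), norm_smul,
        he.1 j₀, mul_one, Real.norm_eq_abs, sq_abs, mul_pow, Real.sq_sqrt hl]
      ring
    calc _ ≤ ∫⁻ g, ENNReal.ofReal ((√(1 - F.a * up * l))⁻¹ ^ s.card *
            Real.exp (F.a * up * ‖v‖ ^ 2 / 2)) *
            ENNReal.ofReal (Real.exp (F.a * up * l * g ^ 2 / 2))
            ∂ProbabilityTheory.gaussianReal 0 1 := by
          refine lintegral_mono fun g => (ih _ fun j hj => ?_).trans (le_of_eq ?_)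
          · rw [inner_add_left, hv j (Finset.mem_insert_of_mem hj), inner_smul_left,
              he.2 (ne_of_mem_of_not_mem hj hj₀).symm]
            simp
          · rw [hnorm, ← ENNReal.ofReal_mul (by positivity), mul_assoc (_ ^ _), ← Real.exp_add]
            congr 3
            ring
      _ = _ := by
          rw [lintegral_const_mul _ (by fun_prop), lintegral_exp_sq_gaussianReal hl',
            ← ENNReal.ofReal_mul (by positivity), Finset.card_insert_of_notMem hj₀]
          congr 1
          ring

/-- The stochastic term attached to a subspace `V`: the normalized squared projection of the noise
onto `V`, together with the noise along the bias `u = θ - P_V θ`, compensated by `‖u‖²`. -/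
noncomputable def excess (lo up : ℝ) {n : ℕ} (V : Submodule ℝ (EuclideanSpace ℝ (Fin n)))
    (θ y : Fin n → ℝ) : ℝ :=
  ‖V.starProjection (F.residual θ y)‖ ^ 2 / (F.a * up)
    - lo / (2 * F.a * up) * inner ℝ (F.residual θ y)
        (WithLp.toLp 2 θ - V.starProjection (WithLp.toLp 2 θ))
    - lo ^ 2 / (16 * F.a * up) * ‖WithLp.toLp 2 θ - V.starProjection (WithLp.toLp 2 θ)‖ ^ 2

@[fun_prop]
theorem measurable_excess (lo up : ℝ) {n : ℕ} (V : Submodule ℝ (EuclideanSpace ℝ (Fin n)))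
    (θ : Fin n → ℝ) : Measurable (F.excess lo up V θ) := by
  unfold excess
  fun_prop

/-- The excess has the exponential moments of a chi-square variable with `finrank V` degrees of
freedom: the compensator makes up for the noise along the bias, at no cost in dimension. -/
theorem lintegral_exp_excess_le {Θ : Set ℝ} {lo up : ℝ} (hA : F.AssumptionA Θ lo up) {n : ℕ}
    (V : Submodule ℝ (EuclideanSpace ℝ (Fin n))) (θ : Fin n → ℝ) {σ : ℝ} (hσ : 0 < σ)
    (hσ' : 2 * σ < 1) :
    ∫⁻ y, ENNReal.ofReal (Real.exp (σ * F.excess lo up V θ y)) ∂F.jointLaw θ ≤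
      ENNReal.ofReal ((√(1 - 2 * σ))⁻¹ ^ Module.finrank ℝ V) := by
  have ha := F.a_pos
  have hup : 0 < up := hA.lo_pos.trans_le hA.lo_le_up
  set u := WithLp.toLp 2 θ - V.starProjection (WithLp.toLp 2 θ) with hu
  let B := stdOrthonormalBasis ℝ V
  have he : Orthonormal ℝ fun j => (B j : EuclideanSpace ℝ (Fin n)) :=
    B.orthonormal.comp_linearIsometry V.subtypeₗᵢ
  have huV : ∀ x ∈ V, inner ℝ u x = 0 := fun x hx =>
    V.starProjection_inner_eq_zero _ x hx
  have hproj : ∀ x, ‖V.starProjection x‖ ^ 2 =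
      ∑ j, inner ℝ x (B j : EuclideanSpace ℝ (Fin n)) ^ 2 := by
    intro x
    rw [Submodule.starProjection_apply, ← Submodule.coe_norm, ← B.sum_sq_norm_inner_right]
    refine Finset.sum_congr rfl fun j _ => ?_
    rw [Real.norm_eq_abs, sq_abs, Submodule.inner_orthogonalProjectionOnto_eq_of_mem_left,
      real_inner_comm]
  set l := 2 * σ / (F.a * up) with hl
  have hal : F.a * up * l = 2 * σ := by rw [hl]; field_simp
  have key := F.lintegral_exp_sum_sq_residual_le hA.le_up θ he (l := l) (by positivity)
    (by rw [hal]; exact hσ') Finset.univ ((-(σ * lo / (2 * F.a * up))) • u)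
    (fun j _ => by rw [inner_smul_left, huV _ (B j).2, mul_zero])
  have hsplit : ∀ y, ENNReal.ofReal (Real.exp (σ * F.excess lo up V θ y)) =
      ENNReal.ofReal (Real.exp (-(σ * (lo ^ 2 / (16 * F.a * up) * ‖u‖ ^ 2)))) *
      ENNReal.ofReal (Real.exp (l / 2 * ∑ j, inner ℝ (F.residual θ y)
        (B j : EuclideanSpace ℝ (Fin n)) ^ 2 +
        inner ℝ (F.residual θ y) ((-(σ * lo / (2 * F.a * up))) • u))) := by
    intro y
    rw [← ENNReal.ofReal_mul (Real.exp_pos _).le, ← Real.exp_add, ← hproj, inner_smul_right,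
      excess, ← hu, hl]
    congr 2
    field_simp
    ring
  simp_rw [hsplit]
  rw [lintegral_const_mul _ (by fun_prop)]
  refine (mul_le_mul_right key _).trans ?_
  rw [hal, Finset.card_univ, Fintype.card_fin, ← ENNReal.ofReal_mul (Real.exp_pos _).le]
  refine ENNReal.ofReal_le_ofReal ?_
  rw [mul_left_comm, ← Real.exp_add]
  refine mul_le_of_le_one_right (by positivity) (Real.exp_le_one_iff.2 ?_)
  rw [norm_smul, mul_pow, Real.norm_eq_abs, sq_abs]
  have : -(σ * (lo ^ 2 / (16 * F.a * up) * ‖u‖ ^ 2)) +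
      F.a * up * ((-(σ * lo / (2 * F.a * up))) ^ 2 * ‖u‖ ^ 2) / 2 =
      -(σ * (1 - 2 * σ) * (lo ^ 2 / (16 * F.a * up) * ‖u‖ ^ 2)) := by
    field_simp
    ring
  rw [this, neg_nonpos]
  have : 0 ≤ 1 - 2 * σ := by linarith
  positivity

/-- The noise in the direction `ζ - θ` is bounded by the excess of any subspace that contains `ζ`,
up to a small multiple of `‖ζ - θ‖²`. -/
theorem noise_le_excess {Θ : Set ℝ} {lo up : ℝ} (hA : F.AssumptionA Θ lo up) {n : ℕ}
    {V : Submodule ℝ (EuclideanSpace ℝ (Fin n))} (θ y ζ : Fin n → ℝ)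
    (hζ : WithLp.toLp 2 ζ ∈ V) :
    (1 / F.a) * F.noise θ y (ζ - θ) ≤
      lo / (8 * F.a) * ∑ i, (ζ i - θ i) ^ 2 + 2 * (up / lo) * F.excess lo up V θ y := by
  have ha := F.a_pos
  have hlo := hA.lo_pos
  have hup : 0 < up := hA.lo_pos.trans_le hA.lo_le_up
  have h0 : F.noise θ y (ζ - θ) =
      inner ℝ (F.residual θ y) (WithLp.toLp 2 ζ - WithLp.toLp 2 θ) := by
    rw [inner_residual]; rfl
  have h1 : ∑ i, (ζ i - θ i) ^ 2 = ‖WithLp.toLp 2 ζ - WithLp.toLp 2 θ‖ ^ 2 := by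
    rw [EuclideanSpace.real_norm_sq_eq]; rfl
  rw [h0, h1, excess]
  generalize F.residual θ y = ε
  generalize WithLp.toLp 2 ζ = z at *
  generalize WithLp.toLp 2 θ = t at *
  set u := t - V.starProjection t with hu
  set w := z - V.starProjection t with hw
  have hwV : w ∈ V := V.sub_mem hζ (V.starProjection_apply_mem t)
  have huw : inner ℝ u w = 0 := V.starProjection_inner_eq_zero _ w hwV
  have hzt : z - t = w - u := by rw [hu, hw]; abel
  have hn : ‖z - t‖ ^ 2 = ‖w‖ ^ 2 + ‖u‖ ^ 2 := by
    rw [hzt, @norm_sub_sq_real, real_inner_comm, huw]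
    ring
  have hi : inner ℝ ε w = inner ℝ (V.starProjection ε) w := by
    rw [Submodule.inner_starProjection_left_eq_right, Submodule.starProjection_eq_self_iff.2 hwV]
  have hcs := real_inner_le_norm (V.starProjection ε) w
  rw [hn, hzt, inner_sub_right, hi]
  have hsq := sq_nonneg (lo * ‖w‖ - 4 * ‖V.starProjection ε‖)
  have hmain : inner ℝ (V.starProjection ε) w ≤
      lo / 8 * ‖w‖ ^ 2 + 2 / lo * ‖V.starProjection ε‖ ^ 2 := by
    refine hcs.trans ?_
    rw [← sub_nonneg]
    have : lo / 8 * ‖w‖ ^ 2 + 2 / lo * ‖V.starProjection ε‖ ^ 2 - ‖V.starProjection ε‖ * ‖w‖ =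
        (lo * ‖w‖ - 4 * ‖V.starProjection ε‖) ^ 2 / (8 * lo) := by
      field_simp
      ring
    rw [this]
    positivity
  calc (1 / F.a) * (inner ℝ (V.starProjection ε) w - inner ℝ ε u)
      ≤ (1 / F.a) * (lo / 8 * ‖w‖ ^ 2 + 2 / lo * ‖V.starProjection ε‖ ^ 2 - inner ℝ ε u) := by
        gcongr
    _ = _ := by
        field_simp
        ring

end NaturalExpFamily

/-! ### The Chernoff parameter -/

/-- With `x = 1 + 2 q`, this is `log x ≤ (x - x⁻¹) / 2 = sinh (log x)`. -/
theorem one_add_two_mul_le_exp {q : ℝ} (hq : 0 ≤ q) :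
    1 + 2 * q ≤ Real.exp (2 * (q * (1 + q) / (1 + 2 * q))) := by
  have hx : 0 < 1 + 2 * q := by linarith
  have h1 : 0 ≤ Real.log (1 + 2 * q) := Real.log_nonneg (by linarith)
  have h2 := Real.self_le_sinh_iff.2 h1
  rw [Real.sinh_eq, Real.exp_neg, Real.exp_log hx] at h2
  rw [← Real.log_le_iff_le_exp hx]
  refine h2.trans (le_of_eq ?_)
  field_simp
  ring

/-- A choice of the exponent `σ` for which the exponential Markov inequality, applied to chi-square
variables with `k` degrees of freedom, produces the deviation `k (A + 2 √(2 w) + 4 w)` at the price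
`exp (-k w)`, with `1 / σ` bounded in terms of `A` alone. -/
theorem exists_chernoff_exponent {A w : ℝ} (hA : 1 < A) (hw : 0 < w) :
    ∃ σ : ℝ, 0 < σ ∧ 2 * σ < 1 ∧ σ⁻¹ ≤ 2 * ((2 * A - 1) / (A - 1)) ∧
      ∀ d k : ℕ, d ≤ k → (√(1 - 2 * σ))⁻¹ ^ d ≤
        Real.exp (σ * (k * (A + 2 * √(2 * w) + 4 * w)) - k * w) := by
  have hA' : 0 < A - 1 := by linarith
  set q₀ := (A - 1) / (2 * A) with hq₀
  have hq₀pos : 0 < q₀ := by positivity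
  have hq₀A : q₀ ≤ A - 1 := div_le_self hA'.le (by linarith)
  set h := √w with hh
  have hhpos : 0 < h := Real.sqrt_pos.2 hw
  have hhw : h ^ 2 = w := Real.sq_sqrt hw.le
  have hh2 : h ≤ √(2 * w) := Real.sqrt_le_sqrt (by linarith)
  -- `1 - 2 σ = (1 + 2 q)⁻¹`: Chernoff's optimal choice is `q = √w`; the lower bound `q₀` on `q`
  -- keeps `1 / σ` bounded when `w` is small.
  set q := max h q₀ with hq
  have hqpos : 0 < q := lt_max_of_lt_left hhpos
  have hqq : q ^ 2 + h ^ 2 ≤ q * (A - 1) + 2 * q * h := by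
    rcases le_total q₀ h with hc | hc
    · rw [hq, max_eq_left hc]
      nlinarith
    · rw [hq, max_eq_right hc]
      nlinarith
  have h12 : 0 < 1 + 2 * q := by linarith
  have hσ : 1 - 2 * (q / (1 + 2 * q)) = (1 + 2 * q)⁻¹ := by
    field_simp
    ring
  refine ⟨q / (1 + 2 * q), by positivity, ?_, ?_, fun d k hdk => ?_⟩
  · have : 0 < (1 + 2 * q)⁻¹ := by positivity
    linarith
  · have h1 : (q / (1 + 2 * q))⁻¹ = q⁻¹ + 2 := by
      field_simp
    have h2 : q⁻¹ ≤ q₀⁻¹ := inv_anti₀ hq₀pos (le_max_right _ _)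
    have h3 : q₀⁻¹ + 2 = 2 * ((2 * A - 1) / (A - 1)) := by
      rw [hq₀]
      have hne := hA'.ne'
      field_simp
      ring
    linarith
  · rw [hσ, Real.sqrt_inv, inv_inv]
    have h1 : √(1 + 2 * q) ≤ Real.exp (q * (1 + q) / (1 + 2 * q)) := by
      rw [Real.sqrt_le_left (Real.exp_pos _).le, ← Real.exp_nat_mul]
      exact_mod_cast one_add_two_mul_le_exp hqpos.le
    have h2 : q * (1 + q) / (1 + 2 * q) ≤
        q / (1 + 2 * q) * (A + 2 * √(2 * w) + 4 * w) - w := by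
      have h3 : q / (1 + 2 * q) * (A + 2 * √(2 * w) + 4 * w) - w =
          (q * (A + 2 * √(2 * w) + 4 * w) - w * (1 + 2 * q)) / (1 + 2 * q) := by
        field_simp
      rw [h3]
      refine div_le_div_of_nonneg_right ?_ h12.le
      have := mul_le_mul_of_nonneg_left hh2 hqpos.le
      nlinarith [mul_pos hqpos hw]
    have h4 : (1 : ℝ) ≤ √(1 + 2 * q) := Real.one_le_sqrt.2 (by linarith)
    calc √(1 + 2 * q) ^ d ≤ √(1 + 2 * q) ^ k := pow_le_pow_right₀ h4 hdk
      _ ≤ Real.exp (q / (1 + 2 * q) * (A + 2 * √(2 * w) + 4 * w) - w) ^ k :=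
          pow_le_pow_left₀ (by positivity) (h1.trans (Real.exp_le_exp.2 h2)) k
      _ = _ := by
          rw [← Real.exp_nat_mul]
          congr 1
          ring

/-! ### Deviations of the excess, uniformly over the models -/

namespace NaturalExpFamily

variable (F : NaturalExpFamily)

/-- The positive part of the deviation of one excess beyond `k (A + 2 √(2 w) + 4 w)` has mean of
order `exp (-k w)`. -/
theorem exists_integrable_excess_le {Θ : Set ℝ} {lo up : ℝ} (hA : F.AssumptionA Θ lo up) {n : ℕ}
    (V : Submodule ℝ (EuclideanSpace ℝ (Fin n))) (θ : Fin n → ℝ) {A w : ℝ} (hA1 : 1 < A)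
    (hw : 0 < w) {k : ℕ} (hk : Module.finrank ℝ V ≤ k) :
    ∃ T : (Fin n → ℝ) → ℝ, Integrable T (F.jointLaw θ) ∧ (∀ y, 0 ≤ T y) ∧
      ∫ y, T y ∂F.jointLaw θ ≤ 2 * ((2 * A - 1) / (A - 1)) * Real.exp (-(k * w)) ∧
      ∀ y, F.excess lo up V θ y - k * (A + 2 * √(2 * w) + 4 * w) ≤ T y := by
  obtain ⟨σ, hσ, hσ', hσD, hpow⟩ := exists_chernoff_exponent hA1 hw
  set c := k * (A + 2 * √(2 * w) + 4 * w) with hc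
  have hm : Measurable fun y => Real.exp (σ * F.excess lo up V θ y) := by fun_prop
  have hlin : ∫⁻ y, ENNReal.ofReal (Real.exp (σ * F.excess lo up V θ y)) ∂F.jointLaw θ ≤
      ENNReal.ofReal (Real.exp (σ * c - k * w)) :=
    (F.lintegral_exp_excess_le hA V θ hσ hσ').trans (ENNReal.ofReal_le_ofReal (hpow _ _ hk))
  have hint : Integrable (fun y => Real.exp (σ * F.excess lo up V θ y)) (F.jointLaw θ) :=
    (lintegral_ofReal_ne_top_iff_integrable hm.aestronglyMeasurable
      (ae_of_all _ fun y => (Real.exp_pos _).le)).1 (hlin.trans_lt ENNReal.ofReal_lt_top).ne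
  have hle : ∫ y, Real.exp (σ * F.excess lo up V θ y) ∂F.jointLaw θ ≤
      Real.exp (σ * c - k * w) := by
    rw [← ENNReal.ofReal_le_ofReal_iff (Real.exp_pos _).le,
      ofReal_integral_eq_lintegral_ofReal hint (ae_of_all _ fun y => (Real.exp_pos _).le)]
    exact hlin
  refine ⟨fun y => σ⁻¹ * Real.exp (-(σ * c)) * Real.exp (σ * F.excess lo up V θ y),
    hint.const_mul _, fun y => by positivity, ?_, fun y => ?_⟩
  · rw [integral_const_mul]
    calc _ ≤ σ⁻¹ * Real.exp (-(σ * c)) * Real.exp (σ * c - k * w) := by gcongr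
      _ = σ⁻¹ * Real.exp (-(k * w)) := by
          rw [mul_assoc, ← Real.exp_add]
          congr 2
          ring
      _ ≤ _ := by gcongr
  · have h1 : σ * (F.excess lo up V θ y - c) ≤
        Real.exp (-(σ * c)) * Real.exp (σ * F.excess lo up V θ y) := by
      rw [← Real.exp_add]
      refine le_trans ?_ (Real.add_one_le_exp _)
      linarith
    beta_reduce
    rw [mul_assoc, ← div_eq_inv_mul, le_div_iff₀' hσ]
    exact h1

end NaturalExpFamily

/-- The span of the columns of `X` with indices in `M`, as a subspace of Euclidean space. -/
noncomputable def modelSpace {n p : ℕ} (X : Matrix (Fin n) (Fin p) ℝ) (M : Finset (Fin p)) :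
    Submodule ℝ (EuclideanSpace ℝ (Fin n)) :=
  (Submodule.span ℝ (X.col '' M)).map (WithLp.linearEquiv 2 ℝ (Fin n → ℝ)).symm.toLinearMap

theorem toLp_mem_modelSpace_iff {n p : ℕ} {X : Matrix (Fin n) (Fin p) ℝ} {M : Finset (Fin p)}
    {ζ : Fin n → ℝ} : WithLp.toLp 2 ζ ∈ modelSpace X M ↔
      ∃ β : Fin p → ℝ, (∀ j ∉ M, β j = 0) ∧ X *ᵥ β = ζ := by
  have h1 : WithLp.toLp 2 ζ ∈ modelSpace X M ↔ ζ ∈ Submodule.span ℝ (X.col '' M) := by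
    rw [modelSpace, Submodule.mem_map]
    constructor
    · rintro ⟨z, hz, hzz⟩
      have : z = ζ := (WithLp.linearEquiv 2 ℝ (Fin n → ℝ)).symm.injective hzz
      rwa [← this]
    · exact fun h => ⟨ζ, h, rfl⟩
  have h2 : ∀ β : Fin p → ℝ, X *ᵥ β = ∑ j, β j • X.col j := fun β => by
    rw [Matrix.mulVec_eq_sum]
    exact Finset.sum_congr rfl fun j _ => op_smul_eq_smul _ _
  rw [h1, Submodule.mem_span_image_finset_iff_exists_fun']
  constructor
  · rintro ⟨c, rfl⟩
    refine ⟨fun j => if j ∈ M then c j else 0, fun j hj => if_neg hj, ?_⟩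
    simp [h2, ite_smul, Finset.sum_ite_mem]
  · rintro ⟨β, hβ, rfl⟩
    refine ⟨β, ?_⟩
    rw [h2]
    exact Finset.sum_subset (Finset.subset_univ _) fun j _ hj => by rw [hβ j hj, zero_smul]

theorem finrank_modelSpace_le {n p : ℕ} (X : Matrix (Fin n) (Fin p) ℝ) (M : Finset (Fin p)) :
    Module.finrank ℝ (modelSpace X M) ≤ M.card := by
  classical
  rw [modelSpace, LinearEquiv.finrank_map_eq, ← Finset.coe_image]
  exact (finrank_span_finset_le_card _).trans Finset.card_image_le

theorem finrank_modelSpace_univ {n p : ℕ} (X : Matrix (Fin n) (Fin p) ℝ) :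
    Module.finrank ℝ (modelSpace X Finset.univ) = X.rank := by
  rw [modelSpace, LinearEquiv.finrank_map_eq, Finset.coe_univ, Set.image_univ,
    Matrix.rank_eq_finrank_span_cols]

/-- All models of maximal size generate the full column space. -/
theorem AdmissibleModels.modelSpace_eq {n p : ℕ} {X : Matrix (Fin n) (Fin p) ℝ}
    {𝔐 : Finset (Finset (Fin p))} (h : AdmissibleModels X 𝔐) {M : Finset (Fin p)}
    (hM : M.card = X.rank) : modelSpace X M = modelSpace X Finset.univ := by
  refine Submodule.eq_of_le_of_finrank_eq
    (Submodule.map_mono (Submodule.span_mono (Set.image_mono (by simp)))) ?_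
  rw [finrank_modelSpace_univ, modelSpace, LinearEquiv.finrank_map_eq, ← hM, Set.image_eq_range]
  have := finrank_span_eq_card (h.linearIndependent M hM)
  simpa using this

namespace NaturalExpFamily

variable (F : NaturalExpFamily)

/-- A single integrable function dominates the deviations of the excess over all admissible models.
The models of maximal size generate the same subspace, and therefore contribute only once. -/
theorem exists_integrable_forall_excess_le {Θ : Set ℝ} {lo up : ℝ} (hA : F.AssumptionA Θ lo up)
    {n p : ℕ} {X : Matrix (Fin n) (Fin p) ℝ} {𝔐 : Finset (Finset (Fin p))}
    (h𝔐 : AdmissibleModels X 𝔐) (hne : 𝔐.Nonempty) (θ : Fin n → ℝ) {w : ℕ → ℝ} {S A : ℝ}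
    (hw : WeightCondition 𝔐 X.rank w S) (hA1 : 1 < A) :
    ∃ T : (Fin n → ℝ) → ℝ, Integrable T (F.jointLaw θ) ∧
      ∫ y, T y ∂F.jointLaw θ ≤ 2 * ((2 * A - 1) / (A - 1)) * S ∧
      ∀ M ∈ 𝔐, ∀ y, F.excess lo up (modelSpace X M) θ y -
        M.card * (A + 2 * √(2 * w M.card) + 4 * w M.card) ≤ T y := by
  classical
  set D := 2 * ((2 * A - 1) / (A - 1)) with hD
  have hDpos : 0 < D := by
    have h1 : 0 < A - 1 := by linarith
    have h2 : 0 < 2 * A - 1 := by linarith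
    positivity
  obtain ⟨M₀, hM₀⟩ := hne
  have hr : 1 ≤ X.rank := (h𝔐.one_le_card M₀ hM₀).trans (h𝔐.card_le_rank M₀ hM₀)
  have hM : ∀ M : {M // M ∈ 𝔐}, ∃ T : (Fin n → ℝ) → ℝ, Integrable T (F.jointLaw θ) ∧
      (∀ y, 0 ≤ T y) ∧ ∫ y, T y ∂F.jointLaw θ ≤ D * Real.exp (-(M.1.card * w M.1.card)) ∧
      ∀ y, F.excess lo up (modelSpace X M.1) θ y -
        M.1.card * (A + 2 * √(2 * w M.1.card) + 4 * w M.1.card) ≤ T y := fun M =>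
    F.exists_integrable_excess_le hA _ θ hA1
      (hw.1 _ (h𝔐.one_le_card M.1 M.2) (h𝔐.card_le_rank M.1 M.2)) (finrank_modelSpace_le X M.1)
  choose T hTi hT0 hTS hTe using hM
  obtain ⟨T', hTi', hT0', hTS', hTe'⟩ := F.exists_integrable_excess_le hA
    (modelSpace X Finset.univ) θ hA1 (hw.1 _ hr le_rfl) (finrank_modelSpace_univ X).le
  set s := 𝔐.attach.filter fun M => M.1.card < X.rank with hs
  refine ⟨fun y => ∑ M ∈ s, T M y + T' y, (integrable_finsetSum _ fun M _ => hTi M).add hTi',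
    ?_, fun M hM y => ?_⟩
  · rw [integral_add (integrable_finsetSum _ fun M _ => hTi M) hTi',
      integral_finsetSum _ fun M _ => hTi M]
    have hcount : ∑ M ∈ s, D * Real.exp (-(M.1.card * w M.1.card)) =
        D * ∑ k ∈ Finset.Ico 1 X.rank,
          (modelCount 𝔐 X.rank k : ℝ) * Real.exp (-(k * w k)) := by
      rw [← Finset.mul_sum, hs, Finset.sum_filter,
        Finset.sum_attach 𝔐 (fun M => if M.card < X.rank then
          Real.exp (-(M.card * w M.card)) else 0), ← Finset.sum_filter]
      have hmaps : ∀ M ∈ 𝔐.filter fun M => M.card < X.rank,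
          M.card ∈ Finset.Ico 1 X.rank := fun M hM => by
        rw [Finset.mem_filter] at hM
        exact Finset.mem_Ico.2 ⟨h𝔐.one_le_card M hM.1, hM.2⟩
      rw [← Finset.sum_fiberwise_of_maps_to hmaps]
      congr 1
      refine Finset.sum_congr rfl fun k hk => ?_
      rw [Finset.mem_Ico] at hk
      rw [modelCount, if_neg hk.2.ne, Finset.filter_filter, Finset.sum_congr rfl
        (g := fun _ => Real.exp (-(k * w k))) fun M hM => by
          rw [(Finset.mem_filter.1 hM).2.2], Finset.sum_const, nsmul_eq_mul]
      congr 3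
      refine Finset.filter_congr fun M _ => ?_
      constructor
      · exact fun h => h.2
      · rintro rfl
        exact ⟨hk.2, rfl⟩
    calc _ ≤ ∑ M ∈ s, D * Real.exp (-(M.1.card * w M.1.card)) +
          D * Real.exp (-(X.rank * w X.rank)) :=
          add_le_add (Finset.sum_le_sum fun M _ => hTS M) hTS'
      _ ≤ D * S := by
          rw [hcount, ← mul_add]
          exact mul_le_mul_of_nonneg_left hw.2 hDpos.le
  · rcases (h𝔐.card_le_rank M hM).lt_or_eq with hlt | heq
    · have h1 := hTe ⟨M, hM⟩ y
      have h2 : T ⟨M, hM⟩ y ≤ ∑ M ∈ s, T M y :=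
        Finset.single_le_sum (f := fun M => T M y) (fun M _ => hT0 M y)
          (Finset.mem_filter.2 ⟨Finset.mem_attach _ _, hlt⟩)
      have h3 := hT0' y
      simp only at h1 ⊢
      linarith
    · have h1 := hTe' y
      have h2 : 0 ≤ ∑ M ∈ s, T M y := Finset.sum_nonneg fun M _ => hT0 M y
      rw [h𝔐.modelSpace_eq heq, heq]
      linarith

end NaturalExpFamily

/-! ### The oracle inequality -/

theorem closure_coeffSet_subset {n p : ℕ} {Θ : Set ℝ} (hΘ : IsClosed Θ)
    (X : Matrix (Fin n) (Fin p) ℝ) (M : Finset (Fin p)) :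
    closure (coeffSet Θ X M) ⊆ {β | (∀ j ∉ M, β j = 0) ∧ ∀ i, (X *ᵥ β) i ∈ Θ} := by
  refine closure_minimal (fun β hβ => ⟨fun j hj => (hβ.1 j).2 hj, hβ.2⟩) ?_
  simp only [Set.ofPred_and, Set.ofPred_forall]
  refine (isClosed_iInter fun j => isClosed_iInter fun _ => ?_).inter
    (isClosed_iInter fun i => ?_)
  · exact isClosed_eq (by fun_prop) continuous_const
  · exact hΘ.preimage (f := fun β : Fin p → ℝ => (X *ᵥ β) i) (by fun_prop)

theorem NaturalExpFamily.continuous_logLik (F : NaturalExpFamily) {n p : ℕ}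
    (X : Matrix (Fin n) (Fin p) ℝ) (y : Fin n → ℝ) : Continuous (F.logLik X y) := by
  have := F.differentiable_b.continuous
  unfold NaturalExpFamily.logLik
  fun_prop

theorem IsMLE.logLik_le_of_mem_closure {n p : ℕ} {F : NaturalExpFamily} {Θ : Set ℝ}
    {X : Matrix (Fin n) (Fin p) ℝ} {M : Finset (Fin p)} {y : Fin n → ℝ} {β β' : Fin p → ℝ}
    (h : IsMLE F Θ X M y β) (hβ' : β' ∈ closure (coeffSet Θ X M)) :
    F.logLik X y β' ≤ F.logLik X y β :=
  closure_minimal (t := {β' | F.logLik X y β' ≤ F.logLik X y β}) h.2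
    (isClosed_le (F.continuous_logLik X y) continuous_const) hβ'

theorem one_le_modelCount {p : ℕ} {𝔐 : Finset (Finset (Fin p))} {M : Finset (Fin p)}
    (hM : M ∈ 𝔐) (r : ℕ) : 1 ≤ modelCount 𝔐 r M.card := by
  have h : 1 ≤ (𝔐.filter fun M' => M'.card = M.card).card :=
    Finset.card_pos.2 ⟨M, Finset.mem_filter.2 ⟨hM, rfl⟩⟩
  unfold modelCount
  split_ifs
  · exact le_min le_rfl h
  · exact h

/-- The estimators exist on an event of probability one, which is nonempty; hence so are the set of
admissible models and all their coefficient sets. -/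
theorem IsPenalizedMLE.nonempty {n p : ℕ} {F : NaturalExpFamily} {Θ : Set ℝ}
    {X : Matrix (Fin n) (Fin p) ℝ} {𝔐 : Finset (Finset (Fin p))} {Pen : ℕ → ℝ}
    {βhat : Finset (Fin p) → (Fin n → ℝ) → (Fin p → ℝ)} {Mhat : (Fin n → ℝ) → Finset (Fin p)}
    (h : IsPenalizedMLE F Θ X 𝔐 Pen βhat Mhat) {θ : Fin n → ℝ} (hθ : ∀ i, θ i ∈ Θ) :
    𝔐.Nonempty ∧ ∀ M ∈ 𝔐, (coeffSet Θ X M).Nonempty := by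
  obtain ⟨y, hy⟩ := (h θ hθ).2.exists
  exact ⟨⟨_, hy.2.1⟩, fun M hM => closure_nonempty_iff.1 ⟨_, (hy.1 M hM).1⟩⟩

/-- The oracle inequality against a fixed vector `β` in the closure of the coefficient set of an
admissible model. -/
theorem klRisk_le_of_mem_closure {F : NaturalExpFamily} {Θ : Set ℝ} {lo up : ℝ} {n p : ℕ}
    {X : Matrix (Fin n) (Fin p) ℝ} {𝔐 : Finset (Finset (Fin p))} {θ : Fin n → ℝ} {w : ℕ → ℝ}
    {S A : ℝ} {Pen : ℕ → ℝ} {βhat : Finset (Fin p) → (Fin n → ℝ) → (Fin p → ℝ)}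
    {Mhat : (Fin n → ℝ) → Finset (Fin p)} (hA : F.AssumptionA Θ lo up)
    (h𝔐 : AdmissibleModels X 𝔐) (hθ : ∀ i, θ i ∈ Θ) (hw : WeightCondition 𝔐 X.rank w S)
    (hA1 : 1 < A)
    (hPen : ∀ k, 1 ≤ k → k ≤ X.rank → 1 ≤ modelCount 𝔐 X.rank k → penaltyBound lo up A w k ≤ Pen k)
    (hest : IsPenalizedMLE F Θ X 𝔐 Pen βhat Mhat) {M : Finset (Fin p)} (hM : M ∈ 𝔐)
    {β : Fin p → ℝ} (hβ : β ∈ closure (coeffSet Θ X M)) :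
    klRisk F X βhat Mhat θ ≤ ENNReal.ofReal (4 / 3 * (F.klReal θ (X *ᵥ β) + Pen M.card) +
      16 / 3 * (up / lo) * ((2 * A - 1) / (A - 1)) * S) := by
  have ha := F.a_pos
  have hlo := hA.lo_pos
  have hup : 0 < up := hA.lo_pos.trans_le hA.lo_le_up
  obtain ⟨T, hTi, hTS, hT⟩ := F.exists_integrable_forall_excess_le hA h𝔐 ⟨M, hM⟩ θ hw hA1
  set ζ := X *ᵥ β with hζ
  -- A quarter of the loss is absorbed into the left-hand side, hence the factors `4 / 3`.
  set G : (Fin n → ℝ) → ℝ := fun y => 4 / 3 * (F.klReal θ ζ + Pen M.card) +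
    (4 / 3 * (1 / F.a) * F.noise θ y (θ - ζ) + 8 / 3 * (up / lo) * T y) with hG
  have hGi1 : Integrable (fun y => 4 / 3 * (1 / F.a) * F.noise θ y (θ - ζ)) (F.jointLaw θ) :=
    (F.integrable_noise θ _).const_mul _
  have hGi2 : Integrable (fun y => 8 / 3 * (up / lo) * T y) (F.jointLaw θ) := hTi.const_mul _
  have hGi : Integrable G (F.jointLaw θ) := (integrable_const _).add (hGi1.add hGi2)
  have hmain : ∀ᵐ y ∂F.jointLaw θ, 0 ≤ G y ∧
      F.KL θ (X *ᵥ βhat (Mhat y) y) ≤ ENNReal.ofReal (G y) := by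
    filter_upwards [(hest θ hθ).2] with y ⟨hmle, hMh, hmin⟩
    obtain ⟨hsupp, hΘ⟩ := closure_coeffSet_subset hA.isClosed X _ (hmle _ hMh).1
    set M' := Mhat y
    set ζ' := X *ᵥ βhat M' y with hζ'
    have h1 := hmin M hM
    have h2 : -(1 / F.a) * F.logLik X y (βhat M y) ≤ -(1 / F.a) * F.logLik X y β := by
      rw [neg_mul, neg_mul, neg_le_neg_iff]
      exact mul_le_mul_of_nonneg_left ((hmle M hM).logLik_le_of_mem_closure hβ) (by positivity)
    have h3 := h1.trans (add_le_add_left h2 _)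
    rw [F.neg_logLik_eq X θ, F.neg_logLik_eq X θ, ← hζ, ← hζ'] at h3
    have h4 := F.noise_le_excess hA θ y ζ'
      (toLp_mem_modelSpace_iff.2 ⟨_, hsupp, rfl⟩ : WithLp.toLp 2 ζ' ∈ modelSpace X M')
    have h5 := F.le_klReal hA hθ hΘ
    have h6 := hPen _ (h𝔐.one_le_card _ hMh) (h𝔐.card_le_rank _ hMh) (one_le_modelCount hMh _)
    rw [penaltyBound, mul_assoc (2 * (up / lo))] at h6
    have h7 := mul_le_mul_of_nonneg_left (hT M' hMh y) (by positivity : 0 ≤ 2 * (up / lo))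
    rw [mul_sub] at h7
    have h8 : lo / (8 * F.a) * ∑ i, (ζ' i - θ i) ^ 2 =
        1 / 4 * (lo / (2 * F.a) * ∑ i, (ζ' i - θ i) ^ 2) := by
      field_simp
      ring
    rw [F.noise_sub, mul_sub, h8] at h4
    have hle : F.klReal θ ζ' ≤ G y := by
      rw [hG]
      simp only
      rw [F.noise_sub]
      linarith
    refine ⟨(F.klReal_nonneg hA hθ hΘ).trans hle, ?_⟩
    rw [F.KL_eq_ofReal]
    exact ENNReal.ofReal_le_ofReal hle
  have hInt : ∫ y, G y ∂F.jointLaw θ ≤ 4 / 3 * (F.klReal θ ζ + Pen M.card) +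
      16 / 3 * (up / lo) * ((2 * A - 1) / (A - 1)) * S := by
    have hGi12 : Integrable (fun y => 4 / 3 * (1 / F.a) * F.noise θ y (θ - ζ) +
        8 / 3 * (up / lo) * T y) (F.jointLaw θ) := hGi1.add hGi2
    rw [hG, integral_add (integrable_const _) hGi12, integral_add hGi1 hGi2,
      integral_const_mul, integral_const_mul, integral_const_mul, F.integral_noise, mul_zero,
      zero_add, integral_const, probReal_univ, one_smul]
    have := mul_le_mul_of_nonneg_left hTS (by positivity : 0 ≤ 8 / 3 * (up / lo))
    linarith
  calc klRisk F X βhat Mhat θ ≤ ∫⁻ y, ENNReal.ofReal (G y) ∂F.jointLaw θ :=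
        lintegral_mono_ae (hmain.mono fun y hy => hy.2)
    _ = ENNReal.ofReal (∫ y, G y ∂F.jointLaw θ) :=
        (ofReal_integral_eq_lintegral_ofReal hGi (hmain.mono fun y hy => hy.1)).symm
    _ ≤ _ := ENNReal.ofReal_le_ofReal hInt

theorem penaltyBound_nonneg {lo up A : ℝ} {w : ℕ → ℝ} {k : ℕ} (hlo : 0 < lo) (hup : lo ≤ up)
    (hA : 1 < A) (hw : 0 < w k) : 0 ≤ penaltyBound lo up A w k := by
  have : 0 < up := hlo.trans_le hup
  unfold penaltyBound
  positivity

/-- The infima over models and coefficients are taken in `ℝ≥0∞`, where the finite terms can be moved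
across by truncated subtraction and division. -/
theorem oracle_inequality {F : NaturalExpFamily} {Θ : Set ℝ} {lo up : ℝ} {n p : ℕ}
    {X : Matrix (Fin n) (Fin p) ℝ} {𝔐 : Finset (Finset (Fin p))} {θ : Fin n → ℝ} {w : ℕ → ℝ}
    {S A : ℝ} {Pen : ℕ → ℝ} {βhat : Finset (Fin p) → (Fin n → ℝ) → (Fin p → ℝ)}
    {Mhat : (Fin n → ℝ) → Finset (Fin p)} (hA : F.AssumptionA Θ lo up)
    (h𝔐 : AdmissibleModels X 𝔐) (hθ : ∀ i, θ i ∈ Θ) (hw : WeightCondition 𝔐 X.rank w S)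
    (hA1 : 1 < A)
    (hPen : ∀ k, 1 ≤ k → k ≤ X.rank → 1 ≤ modelCount 𝔐 X.rank k → penaltyBound lo up A w k ≤ Pen k)
    (hest : IsPenalizedMLE F Θ X 𝔐 Pen βhat Mhat) :
    klRisk F X βhat Mhat θ ≤
      (4 / 3) * (⨅ M ∈ 𝔐,
        ((⨅ β ∈ coeffSet Θ X M, F.KL θ (X *ᵥ β)) + ENNReal.ofReal (Pen M.card)))
      + ENNReal.ofReal (16 / 3 * (up / lo) * ((2 * A - 1) / (A - 1)) * S) := by
  have hfour : (4 / 3 : ℝ≥0∞) = ENNReal.ofReal (4 / 3) := by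
    rw [ENNReal.ofReal_div_of_pos (by norm_num)]
    norm_num
  have h0 : (4 / 3 : ℝ≥0∞) ≠ 0 := by
    rw [hfour]
    exact (ENNReal.ofReal_pos.2 (by norm_num)).ne'
  have htop : (4 / 3 : ℝ≥0∞) ≠ ⊤ := by
    rw [hfour]
    exact ENNReal.ofReal_ne_top
  rw [← tsub_le_iff_right, mul_comm (4 / 3 : ℝ≥0∞), ← ENNReal.div_le_iff h0 htop]
  refine le_iInf₂ fun M hM => ?_
  rw [← tsub_le_iff_right]
  refine le_iInf₂ fun β hβ => ?_
  rw [tsub_le_iff_right, ENNReal.div_le_iff h0 htop, tsub_le_iff_right]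
  refine (klRisk_le_of_mem_closure hA h𝔐 hθ hw hA1 hPen hest hM (subset_closure hβ)).trans ?_
  have hk1 := h𝔐.one_le_card M hM
  have hk2 := h𝔐.card_le_rank M hM
  have hPen0 : 0 ≤ Pen M.card :=
    (penaltyBound_nonneg hA.lo_pos hA.lo_le_up hA1 (hw.1 _ hk1 hk2)).trans
      (hPen _ hk1 hk2 (one_le_modelCount hM _))
  have hkl := F.klReal_nonneg hA hθ hβ.2
  refine ENNReal.ofReal_add_le.trans (add_le_add_left (le_of_eq ?_) _)
  rw [ENNReal.ofReal_mul (by norm_num), ENNReal.ofReal_add hkl hPen0, F.KL_eq_ofReal, hfour,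
    mul_comm]

/-! ### The complexity weights -/

theorem le_complexity {p : ℕ} (𝔐 : Finset (Finset (Fin p))) (r k : ℕ) :
    (k : ℝ) ≤ complexity 𝔐 r k :=
  le_max_right _ _

theorem mul_complexityWeight {p : ℕ} (𝔐 : Finset (Finset (Fin p))) (r : ℕ) (c : ℝ) {k : ℕ}
    (hk : 1 ≤ k) : k * complexityWeight 𝔐 r c k = c * complexity 𝔐 r k := by
  have : (k : ℝ) ≠ 0 := by positivity
  unfold complexityWeight
  field_simp

theorem modelCount_mul_exp_le {p : ℕ} (𝔐 : Finset (Finset (Fin p))) (r : ℕ) {c : ℝ}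
    (hc : 1 < c) {k : ℕ} (hk : 1 ≤ k) :
    modelCount 𝔐 r k * Real.exp (-(k * complexityWeight 𝔐 r c k)) ≤
      Real.exp (-(c - 1)) ^ k := by
  rcases Nat.eq_zero_or_pos (modelCount 𝔐 r k) with h0 | hpos
  · rw [h0]
    simp only [Nat.cast_zero, zero_mul]
    positivity
  have hpos' : (0 : ℝ) < modelCount 𝔐 r k := by exact_mod_cast hpos
  have h1 : Real.log (modelCount 𝔐 r k) ≤ complexity 𝔐 r k := le_max_left _ _
  have h2 := le_complexity 𝔐 r k
  rw [mul_complexityWeight 𝔐 r c hk, ← Real.exp_nat_mul]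
  calc _ = Real.exp (Real.log (modelCount 𝔐 r k) + -(c * complexity 𝔐 r k)) := by
        rw [Real.exp_add, Real.exp_log hpos']
    _ ≤ _ := by
        refine Real.exp_le_exp.2 ?_
        nlinarith

/-- The weighted counts are dominated by a geometric series with ratio `exp (-(c - 1))`. -/
theorem weightCondition_complexityWeight {n p : ℕ} (X : Matrix (Fin n) (Fin p) ℝ)
    (𝔐 : Finset (Finset (Fin p))) {c : ℝ} (hc : 1 < c) :
    WeightCondition 𝔐 X.rank (complexityWeight 𝔐 X.rank c)
      ((1 - Real.exp (-(c - 1)))⁻¹ + 1) := by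
  have hx0 : 0 ≤ Real.exp (-(c - 1)) := (Real.exp_pos _).le
  have hx1 : Real.exp (-(c - 1)) < 1 := Real.exp_lt_one_iff.2 (by linarith)
  refine ⟨fun k hk _ => ?_, add_le_add ?_ ?_⟩
  · have hk' : (0 : ℝ) < k := by exact_mod_cast hk
    have := hk'.trans_le (le_complexity 𝔐 X.rank k)
    unfold complexityWeight
    positivity
  · calc _ ≤ ∑ k ∈ Finset.Ico 1 X.rank, Real.exp (-(c - 1)) ^ k :=
          Finset.sum_le_sum fun k hk =>
            modelCount_mul_exp_le 𝔐 _ hc (Finset.mem_Ico.1 hk).1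
      _ ≤ ∑' k : ℕ, Real.exp (-(c - 1)) ^ k :=
          (summable_geometric_of_lt_one hx0 hx1).sum_le_tsum _ fun k _ => by positivity
      _ = _ := tsum_geometric_of_lt_one hx0 hx1
  · refine Real.exp_le_one_iff.2 (neg_nonpos.2 ?_)
    have := (Nat.cast_nonneg X.rank).trans (le_complexity 𝔐 X.rank X.rank)
    unfold complexityWeight
    positivity

/-- `c = A = 101 / 100` work for all `C > 16`, since `2 (A + 2 √(2 c) + 4 c) < 16`. -/
theorem penaltyBound_complexityWeight_le {lo up C : ℝ} (hlo : 0 < lo) (hup : lo ≤ up)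
    (hC : 16 < C) {p : ℕ} (𝔐 : Finset (Finset (Fin p))) (r : ℕ) {k : ℕ} (hk : 1 ≤ k) :
    penaltyBound lo up (101 / 100) (complexityWeight 𝔐 r (101 / 100)) k ≤
      C * (up / lo) * complexity 𝔐 r k := by
  have hup' : 0 < up := hlo.trans_le hup
  have hk' : (0 : ℝ) < k := by exact_mod_cast hk
  have hx := le_complexity 𝔐 r k
  set x := complexity 𝔐 r k
  have hx0 : 0 < x := hk'.trans_le hx
  set v := complexityWeight 𝔐 r (101 / 100) k
  have hkv : k * v = 101 / 100 * x := mul_complexityWeight 𝔐 r _ hk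
  -- `2 k v = 2.02 x` and `k ≤ x` give `(k √(2 v))² ≤ 2.02 x²`.
  have hsq : k * √(2 * v) ≤ 1425 / 1000 * x := by
    have hv : 0 ≤ v := by
      by_contra hv
      nlinarith
    rw [← pow_le_pow_iff_left₀ (by positivity) (by positivity) two_ne_zero, mul_pow,
      Real.sq_sqrt (by positivity)]
    nlinarith
  have : penaltyBound lo up (101 / 100) (complexityWeight 𝔐 r (101 / 100)) k =
      (up / lo) * (2 * (101 / 100 * k + 2 * (k * √(2 * v)) + 4 * (k * v))) := by
    unfold penaltyBound
    ring
  rw [this, hkv, mul_comm C, mul_assoc]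
  refine mul_le_mul_of_nonneg_left ?_ (by positivity)
  nlinarith

/-! ### Risk bounds -/

/-- Every vector of natural parameters generated by some coefficients is generated by the closure of
the coefficient set of any model of maximal size. -/
theorem AdmissibleModels.exists_mem_closure_coeffSet {n p : ℕ} {X : Matrix (Fin n) (Fin p) ℝ}
    {𝔐 : Finset (Finset (Fin p))} (h𝔐 : AdmissibleModels X 𝔐) {Θ : Set ℝ} (hΘ : Θ.OrdConnected)
    {M : Finset (Fin p)} (hM : M.card = X.rank) (hne : (coeffSet Θ X M).Nonempty)
    {β : Fin p → ℝ} (hβ : ∀ i, (X *ᵥ β) i ∈ Θ) :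
    ∃ β' ∈ closure (coeffSet Θ X M), X *ᵥ β' = X *ᵥ β := by
  have hmem : WithLp.toLp 2 (X *ᵥ β) ∈ modelSpace X M := by
    rw [h𝔐.modelSpace_eq hM]
    exact toLp_mem_modelSpace_iff.2 ⟨β, by simp, rfl⟩
  obtain ⟨β', hsupp, hX⟩ := toLp_mem_modelSpace_iff.1 hmem
  refine ⟨β', ?_, hX⟩
  obtain ⟨β₁, h₁, h₁'⟩ := hne
  -- All but finitely many points of the segment from `β'` to `β₁` have full support in `M`.
  set f : ℝ → Fin p → ℝ := fun t => β' + t • (β₁ - β') with hf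
  have hcont : Filter.Tendsto f (nhdsWithin 0 (Set.Ioi 0)) (nhds β') := by
    have : Continuous f := by fun_prop
    have h := this.tendsto 0
    simp only [hf, zero_smul, add_zero] at h
    exact h.mono_left nhdsWithin_le_nhds
  refine mem_closure_of_tendsto hcont ?_
  have hlt : ∀ᶠ t : ℝ in nhdsWithin 0 (Set.Ioi 0), t < 1 :=
    nhdsWithin_le_nhds (Iio_mem_nhds one_pos)
  have hnz : ∀ j ∈ M, ∀ᶠ t : ℝ in nhdsWithin 0 (Set.Ioi 0), f t j ≠ 0 := by
    intro j hj
    have hβ₁ : β₁ j ≠ 0 := fun h => (h₁ j).1 h hj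
    by_cases hb : β' j = 0
    · filter_upwards [self_mem_nhdsWithin] with t ht
      have : t ≠ 0 := ne_of_gt ht
      simp [hf, hb, hβ₁, this]
    · have : Filter.Tendsto (fun t => f t j) (nhdsWithin 0 (Set.Ioi 0)) (nhds (β' j)) :=
        (tendsto_pi_nhds.1 hcont) j
      exact this.eventually_ne hb
  have hnz' : ∀ᶠ t : ℝ in nhdsWithin 0 (Set.Ioi 0), ∀ j ∈ M, f t j ≠ 0 :=
    (Filter.eventually_all_finset M).2 hnz
  filter_upwards [hlt, hnz', self_mem_nhdsWithin] with t ht hj ht0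
  refine ⟨fun j => ⟨fun h0 hjM => hj j hjM h0, fun hjM => ?_⟩, fun i => ?_⟩
  · simp [hf, hsupp j hjM, (h₁ j).2 hjM]
  · have h2 : (X *ᵥ f t) i = (X *ᵥ β) i + t * ((X *ᵥ β₁) i - (X *ᵥ β) i) := by
      simp [hf, Matrix.mulVec_add, Matrix.mulVec_smul, Matrix.mulVec_sub, hX]
    rw [h2]
    exact hΘ.convex.add_smul_sub_mem (hβ i) (h₁' i) ⟨le_of_lt ht0, ht.le⟩

theorem complexity_rank {p : ℕ} (𝔐 : Finset (Finset (Fin p))) (r : ℕ) :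
    complexity 𝔐 r r = r := by
  refine max_eq_right (le_trans (Real.log_nonpos (by positivity) ?_) (Nat.cast_nonneg r))
  rw [modelCount, if_pos rfl]
  exact_mod_cast min_le_left _ _

/-- The risk bound when the true parameters are represented by the closure of the coefficient set of
an admissible model: there is no approximation error, the penalty contributes `4 / 3 * C'`, and
`544 = 16 / 3 * (2 A - 1) / (A - 1)` for `A = 101 / 100`. -/
theorem klRisk_le_complexity {F : NaturalExpFamily} {Θ : Set ℝ} {lo up : ℝ} {n p : ℕ}
    {X : Matrix (Fin n) (Fin p) ℝ} {𝔐 : Finset (Finset (Fin p))} {C C' : ℝ} (hC : 16 < C)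
    {Pen : ℕ → ℝ} {βhat : Finset (Fin p) → (Fin n → ℝ) → (Fin p → ℝ)}
    {Mhat : (Fin n → ℝ) → Finset (Fin p)} (hA : F.AssumptionA Θ lo up)
    (h𝔐 : AdmissibleModels X 𝔐)
    (hPen : ∀ k, 1 ≤ k → k ≤ X.rank → 1 ≤ modelCount 𝔐 X.rank k →
      C * (up / lo) * complexity 𝔐 X.rank k ≤ Pen k ∧
      Pen k ≤ C' * (up / lo) * complexity 𝔐 X.rank k)
    (hest : IsPenalizedMLE F Θ X 𝔐 Pen βhat Mhat) {M : Finset (Fin p)} (hM : M ∈ 𝔐)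
    {β : Fin p → ℝ} (hβ : β ∈ closure (coeffSet Θ X M)) :
    klRisk F X βhat Mhat (X *ᵥ β) ≤ ENNReal.ofReal
      ((4 / 3 * C' + 544 * ((1 - Real.exp (-(101 / 100 - 1)))⁻¹ + 1)) * (up / lo) *
        complexity 𝔐 X.rank M.card) := by
  have hlo := hA.lo_pos
  have hup : 0 < up := hlo.trans_le hA.lo_le_up
  have hk1 := h𝔐.one_le_card M hM
  have hk2 := h𝔐.card_le_rank M hM
  have hx : 1 ≤ complexity 𝔐 X.rank M.card :=
    le_trans (by exact_mod_cast hk1) (le_complexity 𝔐 X.rank M.card)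
  refine (klRisk_le_of_mem_closure hA h𝔐 (closure_coeffSet_subset hA.isClosed X M hβ).2
    (weightCondition_complexityWeight X 𝔐 (c := 101 / 100) (by norm_num))
    (A := 101 / 100) (by norm_num)
    (fun k h1 h2 h3 => (penaltyBound_complexityWeight_le hlo hA.lo_le_up hC 𝔐 _ h1).trans
      (hPen k h1 h2 h3).1) hest hM hβ).trans (ENNReal.ofReal_le_ofReal ?_)
  have hexp : Real.exp (-(101 / 100 - 1)) < 1 := Real.exp_lt_one_iff.2 (by norm_num)
  have hS : 0 ≤ (1 - Real.exp (-(101 / 100 - 1)))⁻¹ + 1 := by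
    have : 0 < 1 - Real.exp (-(101 / 100 - 1)) := by linarith
    positivity
  generalize (1 - Real.exp (-(101 / 100 - 1)))⁻¹ + 1 = S at *
  have h1 := (hPen _ hk1 hk2 (one_le_modelCount hM _)).2
  have h2 : up / lo * S ≤ up / lo * S * complexity 𝔐 X.rank M.card :=
    le_mul_of_one_le_right (by positivity) hx
  rw [F.klReal_self]
  norm_num
  linarith

theorem mainTheorem4 :
    -- the oracle inequality
    (∀ (F : NaturalExpFamily) (Θ : Set ℝ) (lo up : ℝ) (n p : ℕ) (X : Matrix (Fin n) (Fin p) ℝ)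
      (𝔐 : Finset (Finset (Fin p))) (θ : Fin n → ℝ) (w : ℕ → ℝ) (S A : ℝ) (Pen : ℕ → ℝ)
      (βhat : Finset (Fin p) → (Fin n → ℝ) → (Fin p → ℝ)) (Mhat : (Fin n → ℝ) → Finset (Fin p)),
      F.AssumptionA Θ lo up → AdmissibleModels X 𝔐 → (∀ i, θ i ∈ Θ) →
      WeightCondition 𝔐 X.rank w S → 1 < A →
      (∀ k, 1 ≤ k → k ≤ X.rank → 1 ≤ modelCount 𝔐 X.rank k → penaltyBound lo up A w k ≤ Pen k) →
      IsPenalizedMLE F Θ X 𝔐 Pen βhat Mhat →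
      klRisk F X βhat Mhat θ ≤
        (4 / 3) * (⨅ M ∈ 𝔐,
          ((⨅ β ∈ coeffSet Θ X M, F.KL θ (X *ᵥ β)) + ENNReal.ofReal (Pen M.card)))
        + ENNReal.ofReal (16 / 3 * (up / lo) * ((2 * A - 1) / (A - 1)) * S)) ∧
    -- the weights `(c / k) max (ln m(k), k)` are allowed, with an absolute bound `S`
    (∀ c : ℝ, 1 < c → ∃ S : ℝ, ∀ (n p : ℕ) (X : Matrix (Fin n) (Fin p) ℝ)
      (𝔐 : Finset (Finset (Fin p))), AdmissibleModels X 𝔐 →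
      WeightCondition 𝔐 X.rank (complexityWeight 𝔐 X.rank c) S) ∧
    -- they lead to penalties of the form `C (up / lo) max (ln m(k), k)`
    (∀ C : ℝ, 16 < C → ∃ c A : ℝ, 1 < c ∧ 1 < A ∧ ∀ (lo up : ℝ), 0 < lo → lo ≤ up →
      ∀ (n p : ℕ) (X : Matrix (Fin n) (Fin p) ℝ) (𝔐 : Finset (Finset (Fin p))),
      AdmissibleModels X 𝔐 → ∀ k, 1 ≤ k → k ≤ X.rank → 1 ≤ modelCount 𝔐 X.rank k →
      penaltyBound lo up A (complexityWeight 𝔐 X.rank c) k ≤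
        C * (up / lo) * complexity 𝔐 X.rank k) ∧
    -- the resulting risk bounds
    (∀ C C' : ℝ, 16 < C → C ≤ C' → ∃ K : ℝ, 0 < K ∧
      ∀ (F : NaturalExpFamily) (Θ : Set ℝ) (lo up : ℝ) (n p : ℕ) (X : Matrix (Fin n) (Fin p) ℝ)
      (𝔐 : Finset (Finset (Fin p))) (Pen : ℕ → ℝ)
      (βhat : Finset (Fin p) → (Fin n → ℝ) → (Fin p → ℝ)) (Mhat : (Fin n → ℝ) → Finset (Fin p)),
      F.AssumptionA Θ lo up → AdmissibleModels X 𝔐 →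
      (∀ k, 1 ≤ k → k ≤ X.rank → 1 ≤ modelCount 𝔐 X.rank k →
        C * (up / lo) * complexity 𝔐 X.rank k ≤ Pen k ∧
        Pen k ≤ C' * (up / lo) * complexity 𝔐 X.rank k) →
      IsPenalizedMLE F Θ X 𝔐 Pen βhat Mhat →
      ∀ p₀, 1 ≤ p₀ → p₀ ≤ X.rank →
        (⨆ β ∈ coeffSetOfSize Θ X 𝔐 p₀, klRisk F X βhat Mhat (X *ᵥ β)) ≤
          ENNReal.ofReal (K * (up / lo) * complexity 𝔐 X.rank p₀) ∧
        ((∃ M ∈ 𝔐, M.card = X.rank) →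
          (⨆ β ∈ coeffSetOfSize Θ X 𝔐 p₀, klRisk F X βhat Mhat (X *ᵥ β)) ≤
            ENNReal.ofReal (K * (up / lo) * min (complexity 𝔐 X.rank p₀) X.rank))) := by
  refine ⟨?_, ?_, ?_, ?_⟩
  · intro F Θ lo up n p X 𝔐 θ w S A Pen βhat Mhat hA h𝔐 hθ hw hA1 hPen hest
    exact oracle_inequality hA h𝔐 hθ hw hA1 hPen hest
  · exact fun c hc => ⟨_, fun n p X 𝔐 _ => weightCondition_complexityWeight X 𝔐 hc⟩
  · exact fun C hC => ⟨101 / 100, 101 / 100, by norm_num, by norm_num,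
      fun lo up hlo hup n p X 𝔐 _ k hk _ _ =>
        penaltyBound_complexityWeight_le hlo hup hC 𝔐 X.rank hk⟩
  · intro C C' hC hCC'
    have hexp : Real.exp (-(101 / 100 - 1)) < 1 := Real.exp_lt_one_iff.2 (by norm_num)
    have hexp' : 0 < 1 - Real.exp (-(101 / 100 - 1)) := by linarith
    have hC' : 0 < C' := by linarith
    refine ⟨4 / 3 * C' + 544 * ((1 - Real.exp (-(101 / 100 - 1)))⁻¹ + 1), by positivity, ?_⟩
    intro F Θ lo up n p X 𝔐 Pen βhat Mhat hA h𝔐 hPen hest p₀ hp₀ hp₀r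
    have hbound : ∀ β ∈ coeffSetOfSize Θ X 𝔐 p₀, klRisk F X βhat Mhat (X *ᵥ β) ≤
        ENNReal.ofReal ((4 / 3 * C' + 544 * ((1 - Real.exp (-(101 / 100 - 1)))⁻¹ + 1)) *
          (up / lo) * complexity 𝔐 X.rank p₀) := by
      intro β hβ
      simp only [coeffSetOfSize, Set.mem_iUnion] at hβ
      obtain ⟨M, hM, rfl, hβM⟩ := hβ
      exact klRisk_le_complexity hC hA h𝔐 hPen hest hM (subset_closure hβM)
    refine ⟨iSup₂_le hbound, ?_⟩
    rintro ⟨M, hM, hMr⟩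
    refine iSup₂_le fun β hβ => ?_
    -- If the complexity of `p₀` exceeds the rank, a model of maximal size is compared with instead.
    rcases le_total (complexity 𝔐 X.rank p₀) X.rank with hle | hle
    · rw [min_eq_left hle]
      exact hbound β hβ
    · rw [min_eq_right hle]
      have hβΘ : ∀ i, (X *ᵥ β) i ∈ Θ := by
        simp only [coeffSetOfSize, Set.mem_iUnion] at hβ
        obtain ⟨M', _, _, hβM⟩ := hβ
        exact hβM.2
      obtain ⟨β', hβ', hX⟩ := h𝔐.exists_mem_closure_coeffSet hA.ordConnected hMr
        ((hest.nonempty hβΘ).2 M hM) hβΘ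
      have h := klRisk_le_complexity hC hA h𝔐 hPen hest hM hβ'
      rwa [hX, hMr, complexity_rank] at h
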